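/- Let $G$ be a finitely generated group, let $S$ be any finite generating set of $G$, and regard $G$ as a metric space with the word metric $d_S(g,h)=|g^{-1}h|_S$. For an ultrafilter $\omega$ on $\mathbb N$, a sequence $e=(e_n)$ in $G$ and a sequence $d=(d_n)$ of positive real numbers with $\lim^\omega d_n=\infty$ (so that $\omega$ is non-principal), the asymptotic cone $\operatorname{Con}^\omega(G,e,d)$ is the set of sequences $(x_n)$ in $G$ such that $d_S(x_n,e_n)/d_n$ is bounded on a set of $\omega$-measure one, with the distance $\operatorname{dist}((x_n),(y_n))=\lim^\omega d_S(x_n,y_n)/d_n$ and with sequences at distance $0$ identified. A point $x$ of a space $X$ is a global cut-point if $X\setminus\{x\}$ has at least two connected components. The group $G$ is constricted if all of its asymptotic cones have global cut-points, and wide if none of its asymptotic cones has a global cut-point. Then: 1. If an asymptotic cone $C$ of $G$ has a global cut-point, then either $C$ is simply connected, or for every base point $x\in C$ the group $\pi_1(C,x)$ is uncountable and in fact contains a free subgroup that is not countably generated. 2. If $G$ is constricted, then every asymptotic cone $C$ of $G$ is either simply connected, or for every base point $x\in C$ the group $\pi_1(C,x)$ is uncountable and contains a free subgroup that is not countably generated.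 3. If $G$ is not wide, then $G$ has an asymptotic cone $C$ that is either simply connected, or such that for every base point $x\in C$ the group $\pi_1(C,x)$ is uncountable and contains a free subgroup that is not countably generated. -/

import Mathlib

open Filter Topology

/-! ### Word metrics -/

/-- The word length of `g` with respect to `S`: the least length of a word in the alphabet
`S ∪ S⁻¹` that represents `g` (used only when `S` generates the group). -/
noncomputable def wordLength {G : Type*} [Group G] (S : Finset G) (g : G) : ℕ :=
  sInf {n : ℕ | ∃ l : List G, l.length = n ∧ (∀ a ∈ l, a ∈ S ∨ a⁻¹ ∈ S) ∧ l.prod = g}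

section WordLength

variable {G : Type*} [Group G] {S : Finset G}

theorem exists_word (hS : Subgroup.closure (S : Set G) = ⊤) (g : G) :
    ∃ l : List G, l.length = wordLength S g ∧ (∀ a ∈ l, a ∈ S ∨ a⁻¹ ∈ S) ∧ l.prod = g := by
  have hne : {n : ℕ | ∃ l : List G, l.length = n ∧ (∀ a ∈ l, a ∈ S ∨ a⁻¹ ∈ S) ∧
      l.prod = g}.Nonempty := by
    have hg : g ∈ (Subgroup.closure (S : Set G)).toSubmonoid := by rw [hS]; trivial
    rw [Subgroup.closure_toSubmonoid] at hg
    obtain ⟨l, hl, hp⟩ := Submonoid.exists_list_of_mem_closure hg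
    exact ⟨l.length, l, rfl, fun a ha => by simpa using hl a ha, hp⟩
  exact Nat.sInf_mem hne

theorem wordLength_le (l : List G) (hl : ∀ a ∈ l, a ∈ S ∨ a⁻¹ ∈ S) :
    wordLength S l.prod ≤ l.length :=
  Nat.sInf_le ⟨l, rfl, hl, rfl⟩

theorem wordLength_one : wordLength S (1 : G) = 0 := by
  have h := wordLength_le (S := S) ([] : List G) (by simp)
  simpa using h

theorem eq_one_of_wordLength_eq_zero (hS : Subgroup.closure (S : Set G) = ⊤) {g : G}
    (h : wordLength S g = 0) : g = 1 := by
  obtain ⟨l, hl, -, hp⟩ := exists_word hS g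
  rw [h, List.length_eq_zero_iff] at hl
  rw [← hp, hl, List.prod_nil]

theorem wordLength_mul_le (hS : Subgroup.closure (S : Set G) = ⊤) (g h : G) :
    wordLength S (g * h) ≤ wordLength S g + wordLength S h := by
  obtain ⟨l, hl, hlS, hp⟩ := exists_word hS g
  obtain ⟨m, hm, hmS, hq⟩ := exists_word hS h
  have := wordLength_le (S := S) (l ++ m) (by
    intro a ha
    rcases List.mem_append.1 ha with ha | ha
    · exact hlS a ha
    · exact hmS a ha)
  rwa [List.prod_append, List.length_append, hp, hq, hl, hm] at this

theorem wordLength_inv_le (hS : Subgroup.closure (S : Set G) = ⊤) (g : G) :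
    wordLength S g⁻¹ ≤ wordLength S g := by
  obtain ⟨l, hl, hlS, hp⟩ := exists_word hS g
  have := wordLength_le (S := S) (l.map (fun x => x⁻¹)).reverse (by
    intro a ha
    rw [List.mem_reverse, List.mem_map] at ha
    obtain ⟨b, hb, rfl⟩ := ha
    rw [inv_inv]
    exact (hlS b hb).symm)
  rwa [← List.prod_inv_reverse, hp, List.length_reverse, List.length_map, hl] at this

theorem wordLength_inv (hS : Subgroup.closure (S : Set G) = ⊤) (g : G) :
    wordLength S g⁻¹ = wordLength S g :=
  le_antisymm (wordLength_inv_le hS g) (by simpa using wordLength_inv_le hS g⁻¹)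

end WordLength

/-- The group `G` regarded as a metric space with the word metric of the finite generating
set `S`. -/
@[nolint unusedArguments]
def WordMetricSpace {G : Type*} [Group G] (S : Finset G)
    (_hS : Subgroup.closure (S : Set G) = ⊤) : Type _ := G

/-- The word metric `d(g, h) = |g⁻¹ h|_S`. -/
noncomputable instance WordMetricSpace.instMetricSpace {G : Type*} [Group G] (S : Finset G)
    (hS : Subgroup.closure (S : Set G) = ⊤) : MetricSpace (WordMetricSpace S hS) where
  dist := fun (g h : G) => (wordLength S (g⁻¹ * h) : ℝ)
  dist_self := fun (g : G) => by
    change (wordLength S (g⁻¹ * g) : ℝ) = 0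
    rw [inv_mul_cancel, wordLength_one, Nat.cast_zero]
  dist_comm := fun (g h : G) => by
    change (wordLength S (g⁻¹ * h) : ℝ) = wordLength S (h⁻¹ * g)
    rw [← wordLength_inv hS (g⁻¹ * h), mul_inv_rev, inv_inv]
  dist_triangle := fun (g h k : G) => by
    change (wordLength S (g⁻¹ * k) : ℝ) ≤ wordLength S (g⁻¹ * h) + wordLength S (h⁻¹ * k)
    have := wordLength_mul_le hS (g⁻¹ * h) (h⁻¹ * k)
    rw [mul_assoc, mul_inv_cancel_left] at this
    exact_mod_cast this
  eq_of_dist_eq_zero := fun {g h : G} hgh => by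
    change (wordLength S (g⁻¹ * h) : ℝ) = 0 at hgh
    have h1 : g⁻¹ * h = (1 : G) := eq_one_of_wordLength_eq_zero hS (by exact_mod_cast hgh)
    exact (inv_mul_eq_one (G := G)).1 h1

/-! ### Asymptotic cones -/

/-- The limit of a real sequence along an ultrafilter on `ℕ` (used only for sequences that are
bounded almost surely, for which it exists and is unique). -/
noncomputable def ultraLim (ω : Ultrafilter ℕ) (c : ℕ → ℝ) : ℝ :=
  limUnder (ω : Filter ℕ) c

theorem tendsto_ultraLim (ω : Ultrafilter ℕ) {c : ℕ → ℝ} {M : ℝ}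
    (hc : ∀ᶠ n in (ω : Filter ℕ), 0 ≤ c n ∧ c n ≤ M) :
    Tendsto c (ω : Filter ℕ) (𝓝 (ultraLim ω c)) := by
  have hle : ((ω.map c : Ultrafilter ℝ) : Filter ℝ) ≤ 𝓟 (Set.Icc 0 M) := by
    rw [le_principal_iff]
    exact hc
  obtain ⟨a, -, ha⟩ := isCompact_Icc.ultrafilter_le_nhds _ hle
  exact tendsto_nhds_limUnder ⟨a, ha⟩

/-- A scaling sequence for `ω`: a sequence of positive reals that diverges `ω`-almost surely.
Its existence forces `ω` to be non-principal. -/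
structure ScalingSequence (ω : Ultrafilter ℕ) where
  val : ℕ → ℝ
  pos : ∀ n, 0 < val n
  diverges : ∀ M : ℝ, ∀ᶠ n in (ω : Filter ℕ), M < val n

section Cone

variable (ω : Ultrafilter ℕ) (X : Type*) [MetricSpace X] (e : ℕ → X) (d : ScalingSequence ω)

/-- The sequences `(x n)` in `X` that represent points of the cone: those at finite distance from
the observation sequence `e` in the metrics `dist / d n`. -/
def ConeSequence : Type _ :=
  {x : ℕ → X // ∃ M : ℝ, ∀ᶠ n in (ω : Filter ℕ), dist (x n) (e n) / d.val n < M}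

variable {ω X e d}

theorem ConeSequence.bounded (x y : ConeSequence ω X e d) :
    ∃ M : ℝ, ∀ᶠ n in (ω : Filter ℕ),
      0 ≤ dist (x.1 n) (y.1 n) / d.val n ∧ dist (x.1 n) (y.1 n) / d.val n ≤ M := by
  obtain ⟨M, hM⟩ := x.2
  obtain ⟨N, hN⟩ := y.2
  refine ⟨M + N, ?_⟩
  filter_upwards [hM, hN] with n h1 h2
  refine ⟨div_nonneg dist_nonneg (d.pos n).le, ?_⟩
  calc dist (x.1 n) (y.1 n) / d.val n
      ≤ (dist (x.1 n) (e n) + dist (y.1 n) (e n)) / d.val n :=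
        div_le_div_of_nonneg_right (dist_triangle_right _ _ _) (d.pos n).le
    _ = dist (x.1 n) (e n) / d.val n + dist (y.1 n) (e n) / d.val n := add_div _ _ _
    _ ≤ M + N := (add_lt_add h1 h2).le

theorem ConeSequence.tendsto (x y : ConeSequence ω X e d) :
    Tendsto (fun n => dist (x.1 n) (y.1 n) / d.val n) (ω : Filter ℕ)
      (𝓝 (ultraLim ω fun n => dist (x.1 n) (y.1 n) / d.val n)) := by
  obtain ⟨M, hM⟩ := x.bounded y
  exact tendsto_ultraLim ω hM

/-- The pseudometric `d(x, y) = lim^ω dist (x n) (y n) / d n`. -/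
noncomputable instance ConeSequence.instPseudoMetricSpace :
    PseudoMetricSpace (ConeSequence ω X e d) where
  dist x y := ultraLim ω fun n => dist (x.1 n) (y.1 n) / d.val n
  dist_self x := by
    have h := x.tendsto x
    simp only [dist_self, zero_div] at h ⊢
    exact tendsto_nhds_unique h tendsto_const_nhds
  dist_comm x y := by simp only [dist_comm]
  dist_triangle x y z := by
    refine le_of_tendsto_of_tendsto' (x.tendsto z) ((x.tendsto y).add (y.tendsto z)) fun n => ?_
    rw [← add_div]
    exact div_le_div_of_nonneg_right (dist_triangle _ _ _) (d.pos n).le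

variable (ω X e d)

/-- The asymptotic cone `Con^ω(X, e, d)`: representing sequences modulo distance zero. -/
def AsymptoticCone : Type _ := SeparationQuotient (ConeSequence ω X e d)

noncomputable instance AsymptoticCone.instMetricSpace : MetricSpace (AsymptoticCone ω X e d) :=
  inferInstanceAs (MetricSpace (SeparationQuotient (ConeSequence ω X e d)))

end Cone

/-! ### Cut-points, wide and constricted spaces -/

/-- `x` is a global cut-point of `X`: the complement of `x` has at least two connected
components. -/
def IsGlobalCutPoint {X : Type*} [TopologicalSpace X] (x : X) : Prop :=
  Nontrivial (ConnectedComponents ({x}ᶜ : Set X))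

/-- `X` has a global cut-point. -/
def HasGlobalCutPoint (X : Type*) [TopologicalSpace X] : Prop :=
  ∃ x : X, IsGlobalCutPoint x

/-- `X` is constricted: all of its asymptotic cones have global cut-points. -/
def IsConstricted (X : Type*) [MetricSpace X] : Prop :=
  ∀ (ω : Ultrafilter ℕ) (e : ℕ → X) (d : ScalingSequence ω),
    HasGlobalCutPoint (AsymptoticCone ω X e d)

/-- `X` is wide: none of its asymptotic cones has a global cut-point. -/
def IsWide (X : Type*) [MetricSpace X] : Prop :=
  ∀ (ω : Ultrafilter ℕ) (e : ℕ → X) (d : ScalingSequence ω),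
    ¬ HasGlobalCutPoint (AsymptoticCone ω X e d)

/-! ### The dichotomy -/

/-- `P` contains a free subgroup that is not countably generated. -/
def HasUncountablyGeneratedFreeSubgroup (P : Type*) [Group P] : Prop :=
  ∃ H : Subgroup P, IsFreeGroup H ∧
    ∀ s : Set P, Subgroup.closure s = H → ¬ s.Countable

/-- `X` is simply connected, or its fundamental group (at every base point) is uncountable and
contains an uncountably generated free subgroup. -/
def SimplyConnectedOrLargeFundamentalGroup (X : Type*) [TopologicalSpace X] : Prop :=
  SimplyConnectedSpace X ∨
    ∀ x : X, Uncountable (FundamentalGroup X x) ∧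
      HasUncountablyGeneratedFreeSubgroup (FundamentalGroup X x)

/-!
Only the first claim needs an argument; the other two follow from it at once. An asymptotic cone
`X` of a group is a homogeneous geodesic space (`AsymptoticCone.isGeodesicSpace`,
`AsymptoticCone.isIsometricallyHomogeneous`), so if one point of `X` separates it, then all do.
For such a space `X` there are two cases (`IsGeodesicSpace.simplyConnected_or_large`).

If the interior points of geodesics always separate the end points, then `X` is a real tree, and
is contracted by sliding along geodesics (`IsGeodesicSpace.contractibleSpace`).

Otherwise some interior point of some geodesic `c` does not separate its end points, and then
neither do the points `c t` for `t` in an open interval. As `c t` is a cut-point, some component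
of its complement contains no other point of `c`. These components, with `c t` added, are
uncountably many pairwise disjoint closed *branches*, and collapsing the complement of a branch to
its root `c t` is continuous (`IsGeodesicSpace.exists_branchFamily`). Components of complements of
points are unbounded by homogeneity (`IsGeodesicSpace.exists_mem_pathComponentIn_dist_gt`), so if
`X` is not simply connected, each branch contains a translate of an essential loop, which gives an
essential loop at the root (`IsGeodesicSpace.exists_essential_loop`).

It remains to see that these loops are independent. A wedge of two spaces can be badly behaved at
the wedge point, but branches with distinct roots do not interact: for finitely many branches, the
open sets obtained from `X` by removing all of them but one cover `X`, and the homomorphisms on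
fundamental groupoids induced by collapsing onto the remaining branch are trivial on paths in the
overlaps. By a form of van Kampen's theorem (`Holonomy.exists_glue`) they glue to a homomorphism
from the fundamental group of `X` to the free product of the fundamental groups at the roots,
which takes the loop in a branch to its class in the corresponding free factor
(`BranchFamily.exists_hom`). These classes may be torsion, but products of two of them, from
disjoint pairs of branches, freely generate a free group
(`Monoid.CoprodI.injective_lift_of_mul_of`), and there are uncountably many pairs.
-/

/-! ### Free subgroups of free products -/

/-- Homomorphisms out of a free group agree on a word as soon as the generators occurring in it
have the same images. -/
theorem FreeGroup.lift_apply_eq_of_eqOn {ι M : Type*} [DecidableEq ι] [Group M] {a b : ι → M}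
    (w : FreeGroup ι) (h : ∀ x ∈ w.toWord, a x.1 = b x.1) :
    FreeGroup.lift a w = FreeGroup.lift b w := by
  rw [← FreeGroup.mk_toWord (x := w), FreeGroup.lift_mk, FreeGroup.lift_mk]
  congr 1
  refine List.map_congr_left fun x hx => ?_
  rw [h x hx]

namespace Monoid.CoprodI

variable {ι : Type*} {P : ι × Bool → Type*} [∀ t, Group (P t)]

/-- Substituting `x_i y_i` for the `i`-th generator turns a reduced word of the free group into a
reduced word of the free product: no cancellation occurs, because `x_i` and `y_i` lie in different
factors. -/
theorem exists_word_of_isReduced [DecidableEq ι] (g : ∀ t, P t) (hg : ∀ t, g t ≠ 1) :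
    ∀ L : List (ι × Bool), FreeGroup.IsReduced L →
      ∃ w : Word P,
        w.prod = (L.map fun x => bif x.2 then
          (of (g (x.1, false)) * of (g (x.1, true)) : CoprodI P)
          else (of (g (x.1, false)) * of (g (x.1, true)))⁻¹).prod ∧
        w.fstIdx = L.head?.map fun x => (x.1, !x.2)
  | [], _ => ⟨Word.empty, by simp, by simp [Word.fstIdx, Word.empty]⟩
  | (i, b) :: L, h => by
    have hL : FreeGroup.IsReduced L := h.infix ⟨[(i, b)], [], by simp⟩
    obtain ⟨w, hw, hi⟩ := exists_word_of_isReduced g hg L hL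
    have hne : w.fstIdx ≠ some (i, b) := by
      rw [hi]
      cases L with
      | nil => simp
      | cons x L =>
        have := (FreeGroup.isReduced_cons_cons.1 h).1
        simp only [List.head?_cons, Option.map_some, ne_eq, Option.some.injEq, Prod.mk.injEq,
          not_and]
        intro hx hb
        have := this hx.symm
        rw [← hb] at this
        simp at this
    cases b with
    | true =>
      refine ⟨Word.cons (g (i, false)) (Word.cons (g (i, true)) w hne (hg _))
        (by simp) (hg _), ?_, by simp⟩
      simp [hw, mul_assoc]
    | false =>
      refine ⟨Word.cons (g (i, true))⁻¹ (Word.cons (g (i, false))⁻¹ w hne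
        (inv_ne_one.2 (hg _))) (by simp) (inv_ne_one.2 (hg _)), ?_, by simp⟩
      simp [hw, mul_assoc]

/-- If `x_i ≠ 1` and `y_i ≠ 1` are elements of pairwise distinct factors of a free product, the
products `x_i y_i` freely generate a free subgroup, even when the `x_i` and `y_i` are torsion. -/
theorem injective_lift_of_mul_of (g : ∀ t, P t) (hg : ∀ t, g t ≠ 1) :
    Function.Injective (FreeGroup.lift fun i : ι =>
      (of (g (i, false)) * of (g (i, true)) : CoprodI P)) := by
  classical
  rw [injective_iff_map_eq_one]
  intro u hu
  obtain ⟨w, hw, hi⟩ := exists_word_of_isReduced g hg u.toWord FreeGroup.isReduced_toWord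
  rw [← FreeGroup.mk_toWord (x := u), FreeGroup.lift_mk, ← hw] at hu
  have hw1 : w = Word.empty := Word.equiv.symm.injective (by
    change w.prod = Word.empty.prod
    rw [hu, Word.prod_empty])
  rw [hw1] at hi
  cases h : u.toWord with
  | nil => exact FreeGroup.toWord_eq_nil_iff.1 h
  | cons x L => rw [h] at hi; simp [Word.fstIdx, Word.empty] at hi

end Monoid.CoprodI

/-- An uncountable free family generates a free subgroup that is not countably generated. -/
theorem HasUncountablyGeneratedFreeSubgroup.of_injective {ι : Type*} [Uncountable ι] {P : Type*}
    [Group P] (f : FreeGroup ι →* P) (hf : Function.Injective f) :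
    HasUncountablyGeneratedFreeSubgroup P := by
  have e : FreeGroup ι ≃* f.range := MonoidHom.ofInjective hf
  refine ⟨f.range, ((FreeGroupBasis.ofFreeGroup ι).map e).isFreeGroup, fun s hs hc => ?_⟩
  have : Countable s := hc.to_subtype
  have h1 : Countable (Subgroup.closure s) := by
    rw [FreeGroup.closure_eq_range]
    exact (MonoidHom.rangeRestrict_surjective _).countable
  rw [hs] at h1
  have h2 : Countable (FreeGroup ι) := e.injective.countable
  exact not_countable (α := ι) (FreeGroup.of_injective (α := ι)).countable

/-! ### Holonomies and their gluing -/

/-- A holonomy on `X` with values in a group `Γ`: a functor from the fundamental groupoid of `X`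
to `Γ`, given as a function on homotopy classes of paths that turns concatenation into
multiplication. -/
structure Holonomy (X : Type*) [TopologicalSpace X] (Γ : Type*) [Group Γ] where
  toFun : ∀ {x y : X}, Path.Homotopic.Quotient x y → Γ
  map_trans : ∀ {x y z : X} (p : Path.Homotopic.Quotient x y) (q : Path.Homotopic.Quotient y z),
    toFun (p.trans q) = toFun p * toFun q

namespace Holonomy

variable {X Y Γ Δ : Type*} [TopologicalSpace X] [TopologicalSpace Y] [Group Γ] [Group Δ]

/-- The value of a holonomy on a path. -/
def onPath (μ : Holonomy X Γ) {x y : X} (p : Path x y) : Γ :=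
  μ.toFun (Path.Homotopic.Quotient.mk p)

variable (μ : Holonomy X Γ)

theorem onPath_trans {x y z : X} (p : Path x y) (q : Path y z) :
    μ.onPath (p.trans q) = μ.onPath p * μ.onPath q := by
  rw [onPath, Path.Homotopic.Quotient.mk_trans, map_trans]
  rfl

theorem onPath_eq_of_homotopic {x y : X} {p q : Path x y} (h : p.Homotopic q) :
    μ.onPath p = μ.onPath q :=
  congrArg μ.toFun (Path.Homotopic.Quotient.eq.2 h)

/-- A holonomy only depends on the underlying function of a path; the end points need not agree
definitionally. -/
theorem onPath_congr {x y x' y' : X} (p : Path x y) (q : Path x' y') (h : ∀ t, p t = q t) :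
    μ.onPath p = μ.onPath q := by
  obtain rfl : x = x' := by simpa using h 0
  obtain rfl : y = y' := by simpa using h 1
  congr 1
  exact Path.ext (funext h)

theorem onPath_refl (x : X) : μ.onPath (Path.refl x) = 1 := by
  have h := μ.onPath_trans (Path.refl x) (Path.refl x)
  rw [Path.refl_trans_refl] at h
  exact left_eq_mul.1 h

theorem onPath_of_const {x y : X} (p : Path x y) (h : ∀ t, p t = x) : μ.onPath p = 1 := by
  rw [μ.onPath_congr p (Path.refl x) h, onPath_refl]

theorem onPath_symm {x y : X} (p : Path x y) : μ.onPath p.symm = (μ.onPath p)⁻¹ := by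
  rw [eq_inv_iff_mul_eq_one, ← onPath_trans, ← μ.onPath_refl y]
  exact μ.onPath_eq_of_homotopic ⟨(Path.Homotopy.reflSymmTrans p).symm⟩

/-- The pull-back of a holonomy along a continuous map. -/
def comap (f : C(X, Y)) (μ : Holonomy Y Γ) : Holonomy X Γ where
  toFun p := μ.toFun (p.map f)
  map_trans p q := by
    induction p, q using Path.Homotopic.Quotient.ind₂ with
    | mk p q =>
      rw [← Path.Homotopic.Quotient.mk_trans, ← Path.Homotopic.Quotient.mk_map, Path.map_trans,
        Path.Homotopic.Quotient.mk_trans, map_trans]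
      rfl

theorem comap_onPath (f : C(X, Y)) (μ : Holonomy Y Γ) {x y : X} (p : Path x y) :
    (μ.comap f).onPath p = μ.onPath (p.map f.continuous) := rfl

/-- The image of a holonomy under a group homomorphism. -/
def postcomp (φ : Γ →* Δ) (μ : Holonomy X Γ) : Holonomy X Δ where
  toFun p := φ (μ.toFun p)
  map_trans p q := by rw [map_trans, map_mul]

theorem postcomp_onPath (φ : Γ →* Δ) (μ : Holonomy X Γ) {x y : X} (p : Path x y) :
    (μ.postcomp φ).onPath p = φ (μ.onPath p) := rfl

/-- The homomorphism from the fundamental group defined by a holonomy. The inverse is there because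
multiplication in `FundamentalGroup` is concatenation in the opposite order. -/
noncomputable def toHom (μ : Holonomy X Γ) (x : X) : FundamentalGroup X x →* Γ :=
  MonoidHom.mk' (fun g => (μ.toFun (FundamentalGroup.toPath g))⁻¹) fun p q => by
    rw [← mul_inv_rev, ← map_trans]
    rfl

theorem toHom_mk {x : X} (p : Path x x) :
    μ.toHom x (FundamentalGroup.fromPath (Path.Homotopic.Quotient.mk p)) = (μ.onPath p)⁻¹ := rfl

open Classical in
/-- A path from `x₀` to `x`, which is constant if `x = x₀`. -/
noncomputable def basePath [PathConnectedSpace X] (x₀ x : X) : Path x₀ x :=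
  if h : x = x₀ then (Path.refl x₀).cast rfl h else PathConnectedSpace.somePath x₀ x

theorem basePath_self [PathConnectedSpace X] (x₀ : X) : basePath x₀ x₀ = Path.refl x₀ := by
  simp [basePath]

/-- The tautological holonomy of a path connected space, with values in its fundamental group: paths
are closed up by the chosen paths from the base point, and the inverse makes up for the order of
multiplication, as in `toHom`. -/
noncomputable def tautological [PathConnectedSpace X] (x₀ : X) :
    Holonomy X (FundamentalGroup X x₀) where
  toFun {x y} p := (FundamentalGroup.fromPath
    (((Path.Homotopic.Quotient.mk (basePath x₀ x)).trans p).trans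
      (Path.Homotopic.Quotient.mk (basePath x₀ y)).symm))⁻¹
  map_trans p q := by
    rw [← mul_inv_rev, inv_inj, FundamentalGroup.mul_def]
    simp only [Path.Homotopic.Quotient.trans_assoc, FundamentalGroup.fromPath,
      FundamentalGroup.fromArrow]
    congr 2
    rw [← Path.Homotopic.Quotient.trans_assoc (Path.Homotopic.Quotient.symm _),
      Path.Homotopic.Quotient.symm_trans, Path.Homotopic.Quotient.refl_trans]

theorem tautological_onPath [PathConnectedSpace X] {x₀ : X} (p : Path x₀ x₀) :
    (tautological x₀).onPath p =
      (FundamentalGroup.fromPath (Path.Homotopic.Quotient.mk p))⁻¹ := by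
  rw [onPath, tautological, inv_inj, basePath_self, Path.Homotopic.Quotient.mk_refl,
    Path.Homotopic.Quotient.refl_trans]
  change Path.Homotopic.Quotient.trans _ (Path.Homotopic.Quotient.mk _) = _
  rw [Path.refl_symm, Path.Homotopic.Quotient.mk_refl, Path.Homotopic.Quotient.trans_refl]

end Holonomy

namespace Holonomy

section Primitive

variable {X Γ : Type*} [TopologicalSpace X] [Group Γ]
variable {V W : Type*} [NormedAddCommGroup V] [NormedSpace ℝ V] [NormedAddCommGroup W]
  [NormedSpace ℝ W]

/-- The value of a holonomy on the image of a straight segment. -/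
noncomputable def onSegment (μ : Holonomy X Γ) (h : C(V, X)) (x y : V) : Γ :=
  μ.onPath ((Path.segment x y).map h.continuous)

theorem onSegment_trans (μ : Holonomy X Γ) (h : C(V, X)) (x y z : V) :
    μ.onSegment h x y * μ.onSegment h y z = μ.onSegment h x z := by
  rw [onSegment, onSegment, ← onPath_trans, ← Path.map_trans]
  exact μ.onPath_eq_of_homotopic
    ((SimplyConnectedSpace.paths_homotopic ((Path.segment x y).trans (Path.segment y z))
      (Path.segment x z)).map h)

theorem onSegment_self (μ : Holonomy X Γ) (h : C(V, X)) (x : V) : μ.onSegment h x x = 1 :=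
  μ.onPath_of_const _ fun t => by simp

variable {ι : Type*}

/-- `s` is a primitive over `K` of the local holonomies `μ i` pulled back along `h`: on short
segments that `h` maps into `U i`, the holonomy `μ i` is the increment of `s`. -/
def IsPrimitive (μ : ι → Holonomy X Γ) (U : ι → Set X) (h : C(V, X)) (K : Set V) (s : V → Γ) :
    Prop :=
  ∃ δ > 0, ∀ x ∈ K, ∀ y ∈ K, dist x y < δ → ∀ i, (∀ t, h (Path.segment x y t) ∈ U i) →
    s y = s x * (μ i).onSegment h x y

/-- The local holonomies `μ i` on `U i` agree on overlaps. -/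
def Compatible (μ : ι → Holonomy X Γ) (U : ι → Set X) : Prop :=
  ∀ i j x y (p : Path x y), (∀ t, p t ∈ U i) → (∀ t, p t ∈ U j) → (μ i).onPath p = (μ j).onPath p

variable {μ : ι → Holonomy X Γ} {U : ι → Set X}

theorem segment_mem_of_ball {x y z : V} {δ : ℝ} (hy : y ∈ Metric.ball x δ)
    (hz : z ∈ Metric.ball x δ) (t : unitInterval) : Path.segment y z t ∈ Metric.ball x δ := by
  have : Path.segment y z t ∈ segment ℝ y z := by
    rw [← Path.range_segment]
    exact ⟨t, rfl⟩
  exact (convex_ball x δ).segment_subset hy hz this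

theorem exists_lebesgue_number {E : Type*} [PseudoMetricSpace E] (hU : ∀ i, IsOpen (U i))
    (hc : ∀ x, ∃ i, x ∈ U i) (h : C(E, X)) {K : Set E} (hK : IsCompact K) :
    ∃ δ > 0, ∀ x ∈ K, ∃ i, ∀ y ∈ Metric.ball x δ, h y ∈ U i := by
  obtain ⟨δ, hδ, H⟩ := lebesgue_number_lemma_of_metric (c := fun i => h ⁻¹' U i) hK
    (fun i => (hU i).preimage h.continuous) (fun x _ => by simpa using hc (h x))
  exact ⟨δ, hδ, H⟩

/-- Primitives exist over compact star-convex sets: multiply the local holonomies along a fine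
subdivision of the segment from the centre of `K`. -/
theorem exists_isPrimitive (hU : ∀ i, IsOpen (U i)) (hc : ∀ x, ∃ i, x ∈ U i)
    (hμ : Compatible μ U) (h : C(V, X)) {K : Set V} (hK : IsCompact K) {o : V}
    (ho : StarConvex ℝ o K) : ∃ s, IsPrimitive μ U h K s := by
  obtain ⟨δ, hδ, H⟩ := exists_lebesgue_number hU hc h hK
  rcases K.eq_empty_or_nonempty with rfl | ⟨x₀, hx₀⟩
  · exact ⟨fun _ => 1, 1, one_pos, by simp⟩
  have : Nonempty ι := ⟨(H x₀ hx₀).choose⟩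
  choose! idx hidx using H
  have hseg : ∀ x ∈ K, ∀ y ∈ Metric.ball x δ, ∀ z ∈ Metric.ball x δ, ∀ i,
      (∀ t, h (Path.segment y z t) ∈ U i) →
      (μ i).onSegment h y z = (μ (idx x)).onSegment h y z := fun x hx y hy z hz i hi =>
    hμ _ _ _ _ _ hi fun t => hidx x hx _ (segment_mem_of_ball hy hz t)
  obtain ⟨R, hR⟩ := hK.isBounded.subset_closedBall o
  obtain ⟨N, hN⟩ := exists_nat_gt (max 0 (2 * R / δ))
  have hN0 : (0 : ℝ) < N := lt_of_le_of_lt (le_max_left _ _) hN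
  have hNR : R / N < δ / 2 := by
    have := lt_of_le_of_lt (le_max_right _ _) hN
    rw [div_lt_iff₀ hδ] at this
    rw [div_lt_iff₀ hN0]
    linarith
  let pt : ℕ → V → V := fun k x => AffineMap.lineMap o x ((k : ℝ) / N)
  let c : V → V → Γ := fun x y => (μ (idx x)).onSegment h x y
  let P : ℕ → V → Γ := fun k x => Nat.rec 1 (fun k r => r * c (pt k x) (pt (k + 1) x)) k
  have hPs : ∀ k x, P (k + 1) x = P k x * c (pt k x) (pt (k + 1) x) := fun k x => rfl
  have hptK : ∀ k ≤ N, ∀ x ∈ K, pt k x ∈ K := by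
    intro k hk x hx
    have hk' : (k : ℝ) ≤ N := by exact_mod_cast hk
    refine ho.segment_subset hx ?_
    rw [segment_eq_image_lineMap]
    exact ⟨(k : ℝ) / N, ⟨by positivity, (div_le_one hN0).2 hk'⟩, rfl⟩
  have hpt1 : ∀ k, ∀ x ∈ K, dist (pt (k + 1) x) (pt k x) < δ / 2 := by
    intro k x hx
    have h1 : dist x o ≤ R := hR hx
    simp only [pt]
    rw [dist_lineMap_lineMap, Real.dist_eq, ← sub_div]
    push_cast
    rw [add_sub_cancel_left, abs_of_nonneg (by positivity), dist_comm o x]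
    calc 1 / (N : ℝ) * dist x o ≤ 1 / (N : ℝ) * R := by gcongr
      _ = R / N := by ring
      _ < δ / 2 := hNR
  have hpt2 : ∀ k ≤ N, ∀ x y, dist (pt k y) (pt k x) ≤ dist x y := by
    intro k hk x y
    have hk' : (k : ℝ) ≤ N := by exact_mod_cast hk
    have h1 : (k : ℝ) / N ≤ 1 := (div_le_one hN0).2 hk'
    have h0 : 0 ≤ (k : ℝ) / N := by positivity
    have : pt k y - pt k x = ((k : ℝ) / N) • (y - x) := by
      simp only [pt, AffineMap.lineMap_apply_module]
      module
    rw [dist_eq_norm, this, norm_smul, Real.norm_of_nonneg h0, dist_comm, dist_eq_norm]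
    exact mul_le_of_le_one_left (norm_nonneg _) h1
  have key : ∀ k ≤ N, ∀ x ∈ K, ∀ y ∈ K, dist x y < δ / 2 →
      P k y = P k x * c (pt k x) (pt k y) := by
    intro k
    induction k with
    | zero =>
      intro _ x _ y _ _
      simp [P, pt, c, onSegment_self]
    | succ k ih =>
      intro hk x hx y hy hxy
      have hk' : k ≤ N := by omega
      rw [hPs, hPs, ih hk' x hx y hy hxy]
      -- everything takes place in the `δ`-ball around `a`, where one single holonomy is in force
      set a := pt k x
      set a' := pt (k + 1) x
      set b := pt k y
      set b' := pt (k + 1) y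
      have haK : a ∈ K := hptK k hk' x hx
      have ha'K : a' ∈ K := hptK _ hk x hx
      have hbK : b ∈ K := hptK k hk' y hy
      have ha' : dist a' a < δ / 2 := hpt1 k x hx
      have hb : dist b a < δ / 2 := (hpt2 k hk' x y).trans_lt hxy
      have hb'b : dist b' b < δ / 2 := hpt1 k y hy
      have hb'a' : dist b' a' < δ / 2 := (hpt2 _ hk x y).trans_lt hxy
      have hb' : dist b' a < δ := by linarith [dist_triangle b' b a]
      have e1 : c b b' = (μ (idx a)).onSegment h b b' :=
        hseg a haK b (by simp; linarith) b' hb' _ fun t =>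
          hidx b hbK _ (segment_mem_of_ball (by simpa using hδ) (by simp; linarith) t)
      have e2 : c a' b' = (μ (idx a)).onSegment h a' b' :=
        hseg a haK a' (by simp; linarith) b' hb' _ fun t =>
          hidx a' ha'K _ (segment_mem_of_ball (by simpa using hδ) (by simp; linarith) t)
      rw [e1, e2]
      simp only [c, mul_assoc, onSegment_trans]
  refine ⟨P N, δ / 2, half_pos hδ, fun x hx y hy hxy i hi => ?_⟩
  have hN1 : ∀ x, pt N x = x := fun x => by simp [pt, div_self hN0.ne']
  rw [key N le_rfl x hx y hy hxy, hN1, hN1,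
    hseg x hx x (by simpa using hδ) y (by rw [Metric.mem_ball, dist_comm]; linarith) i hi]

/-- Primitives restrict along short affine maps. -/
theorem IsPrimitive.comp {h : C(V, X)} {K : Set V} {s : V → Γ} (hs : IsPrimitive μ U h K s)
    (j : W →ᵃ[ℝ] V) (hj : ∀ x y, dist (j x) (j y) ≤ dist x y) {h' : C(W, X)} {L : Set W}
    (hL : Convex ℝ L) (hjL : ∀ x ∈ L, j x ∈ K) (hh : ∀ x ∈ L, h' x = h (j x)) :
    IsPrimitive μ U h' L (s ∘ j) := by
  obtain ⟨δ, hδ, H⟩ := hs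
  refine ⟨δ, hδ, fun x hx y hy hxy i hi => ?_⟩
  have e : ∀ t, h' (Path.segment x y t) = h (Path.segment (j x) (j y) t) := by
    intro t
    have ht : Path.segment x y t ∈ L := by
      refine hL.segment_subset hx hy ?_
      rw [← Path.range_segment]
      exact ⟨t, rfl⟩
    rw [hh _ ht, Path.segment_apply, Path.segment_apply, AffineMap.apply_lineMap]
  rw [Function.comp_apply, Function.comp_apply,
    H (j x) (hjL x hx) (j y) (hjL y hy) ((hj x y).trans_lt hxy) i fun t => e t ▸ hi t]
  congr 1
  exact ((μ i).onPath_congr _ _ e).symm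

/-- The increment over the unit interval does not depend on the primitive. -/
theorem IsPrimitive.increment_eq (hU : ∀ i, IsOpen (U i)) (hc : ∀ x, ∃ i, x ∈ U i)
    {h : C(ℝ, X)} {s s' : ℝ → Γ} (hs : IsPrimitive μ U h (Set.Icc 0 1) s)
    (hs' : IsPrimitive μ U h (Set.Icc 0 1) s') : (s 0)⁻¹ * s 1 = (s' 0)⁻¹ * s' 1 := by
  obtain ⟨δ₁, hδ₁, H₁⟩ := hs
  obtain ⟨δ₂, hδ₂, H₂⟩ := hs'
  obtain ⟨δ₃, hδ₃, H₃⟩ := exists_lebesgue_number hU hc h (isCompact_Icc (a := (0 : ℝ)) (b := 1))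
  obtain ⟨N, hN⟩ := exists_nat_one_div_lt (lt_min (lt_min hδ₁ hδ₂) hδ₃)
  have hstep : ∀ k : ℕ, k ≤ N + 1 →
      s ((k : ℝ) / (N + 1)) * (s' ((k : ℝ) / (N + 1)))⁻¹ = s 0 * (s' 0)⁻¹ := by
    intro k
    induction k with
    | zero => simp
    | succ k ih =>
      intro hk
      rw [← ih (by omega)]
      have hN0 : (0 : ℝ) < N + 1 := by positivity
      have hmem : ∀ m : ℕ, m ≤ N + 1 → (m : ℝ) / (N + 1) ∈ Set.Icc (0 : ℝ) 1 := fun m hm =>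
        ⟨by positivity, (div_le_one hN0).2 (by exact_mod_cast hm)⟩
      set x := (k : ℝ) / (N + 1)
      set y := ((k + 1 : ℕ) : ℝ) / (N + 1)
      have hx := hmem k (by omega)
      have hy := hmem (k + 1) hk
      have hd : dist x y = 1 / (N + 1) := by
        rw [dist_comm, Real.dist_eq, ← sub_div]
        push_cast
        rw [add_sub_cancel_left, abs_of_nonneg (by positivity)]
      rw [← hd] at hN
      obtain ⟨i, hi⟩ := H₃ x hx
      have hseg : ∀ t, h (Path.segment x y t) ∈ U i := fun t =>
        hi _ (segment_mem_of_ball (by simpa using hδ₃)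
          (by rw [Metric.mem_ball, dist_comm]; exact hN.trans_le (min_le_right _ _)) t)
      rw [H₁ x hx y hy (hN.trans_le ((min_le_left _ _).trans (min_le_left _ _))) i hseg,
        H₂ x hx y hy (hN.trans_le ((min_le_left _ _).trans (min_le_right _ _))) i hseg]
      group
  have h1 := hstep (N + 1) le_rfl
  push_cast at h1
  rw [div_self (by positivity)] at h1
  rw [inv_mul_eq_iff_eq_mul, ← mul_assoc, ← h1]
  group

end Primitive

section Glue

variable {X Γ ι : Type*} [TopologicalSpace X] [Group Γ] {μ : ι → Holonomy X Γ} {U : ι → Set X}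

theorem isPrimitive_of_forall_mem (hμ : Compatible μ U) {x y : X} (p : Path x y) (i : ι)
    (hp : ∀ t, p t ∈ U i) :
    IsPrimitive μ U p.extend (Set.Icc 0 1) fun x => (μ i).onSegment p.extend 0 x := by
  refine ⟨1, one_pos, fun x _ y _ _ j hj => ?_⟩
  change (μ i).onSegment p.extend 0 y = (μ i).onSegment p.extend 0 x * _
  rw [← onSegment_trans _ _ 0 x y]
  congr 1
  refine hμ _ _ _ _ _ (fun t => ?_) hj
  obtain ⟨u, hu⟩ : p.extend (Path.segment x y t) ∈ Set.range p := by
    rw [← Path.extend_range]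
    exact ⟨_, rfl⟩
  rw [Path.map_coe, Function.comp_apply, ← hu]
  exact hp u

/-- Van Kampen's theorem in the form needed here: local holonomies on the members of an open cover
which agree on overlaps come from a single holonomy. The last clause says that this holonomy is
trivial on a path, however many members of the cover it crosses, if each local holonomy is trivial
on all paths inside its image. -/
theorem exists_glue (hU : ∀ i, IsOpen (U i)) (hc : ∀ x, ∃ i, x ∈ U i) (hμ : Compatible μ U) :
    ∃ ν : Holonomy X Γ,
      (∀ i x y (p : Path x y), (∀ t, p t ∈ U i) → ν.onPath p = (μ i).onPath p) ∧
      ∀ x y (p : Path x y), (∀ i x' y' (γ : Path x' y'), (∀ t, γ t ∈ Set.range p) →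
        (μ i).onPath γ = 1) → ν.onPath p = 1 := by
  have hstar : StarConvex ℝ (0 : ℝ) (Set.Icc 0 1) :=
    (convex_Icc (0 : ℝ) 1).starConvex (by simp)
  have hprim : ∀ {x y : X} (p : Path x y), ∃ s, IsPrimitive μ U p.extend (Set.Icc 0 1) s :=
    fun p => exists_isPrimitive hU hc hμ p.extend isCompact_Icc hstar
  choose prim hprim using @hprim
  let inc : ∀ {x y : X}, Path x y → Γ := fun p => (prim p 0)⁻¹ * prim p 1
  have hinc : ∀ {x y : X} (p : Path x y) (s : ℝ → Γ),
      IsPrimitive μ U p.extend (Set.Icc 0 1) s → inc p = (s 0)⁻¹ * s 1 := fun p s hs =>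
    (hprim p).increment_eq hU hc hs
  have hconst : ∀ (x : X) (s : ℝ → Γ),
      IsPrimitive μ U (Path.refl x).extend (Set.Icc 0 1) s → s 0 = s 1 := by
    intro x s hs
    obtain ⟨i, hi⟩ := hc x
    have h := hs.increment_eq hU hc
      (isPrimitive_of_forall_mem hμ (Path.refl x) i fun _ => by simpa using hi)
    have hval : (μ i).onSegment (Path.refl x).extend 0 1 = 1 := onPath_of_const _ _ fun t => by
      rw [Path.map_coe, Function.comp_apply, Path.refl_extend]
      rfl
    rw [onSegment_self, hval, inv_one, one_mul, inv_mul_eq_one] at h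
    exact h
  have hhom : ∀ {x y : X} (p q : Path x y), p.Homotopic q → inc p = inc q := by
    rintro x y p q ⟨F⟩
    -- a primitive of the homotopy on the unit square, restricted to the four sides
    let pr : C(ℝ, unitInterval) := ⟨Set.projIcc 0 1 zero_le_one, continuous_projIcc⟩
    let h : C(ℝ × ℝ, X) := ⟨fun z => F (pr z.1, pr z.2), by fun_prop⟩
    have hpr0 : pr 0 = 0 := by simp [pr]
    have hpr1 : pr 1 = 1 := by simp [pr]
    obtain ⟨s, hs⟩ := exists_isPrimitive hU hc hμ h
      (isCompact_Icc (a := (0 : ℝ)) (b := 1) |>.prod (isCompact_Icc (a := (0 : ℝ)) (b := 1)))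
      (o := (0, 0)) (((convex_Icc (0 : ℝ) 1).prod (convex_Icc (0 : ℝ) 1)).starConvex (by simp))
    have horiz : ∀ a ∈ Set.Icc (0 : ℝ) 1, ∀ h' : C(ℝ, X),
        (∀ x ∈ Set.Icc (0 : ℝ) 1, h' x = h (a, x)) →
        IsPrimitive μ U h' (Set.Icc 0 1) fun x => s (a, x) := by
      intro a ha h' hh
      refine hs.comp (j := (AffineMap.const ℝ ℝ a).prod (AffineMap.id ℝ ℝ)) ?_ (convex_Icc _ _)
        ?_ ?_
      · intro x y; simp [Prod.dist_eq]
      · intro x hx; exact ⟨ha, hx⟩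
      · intro x hx; exact hh x hx
    have vert : ∀ a ∈ Set.Icc (0 : ℝ) 1, ∀ h' : C(ℝ, X),
        (∀ x ∈ Set.Icc (0 : ℝ) 1, h' x = h (x, a)) →
        IsPrimitive μ U h' (Set.Icc 0 1) fun x => s (x, a) := by
      intro a ha h' hh
      refine hs.comp (j := (AffineMap.id ℝ ℝ).prod (AffineMap.const ℝ ℝ a)) ?_ (convex_Icc _ _)
        ?_ ?_
      · intro x y; simp [Prod.dist_eq]
      · intro x hx; exact ⟨hx, ha⟩
      · intro x hx; exact hh x hx
    have e1 := hinc p _ (horiz 0 (by simp) p.extend fun x hx => by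
      change _ = F (pr 0, pr x)
      rw [hpr0, Path.extend_apply _ hx]
      simp [pr, Set.projIcc_of_mem zero_le_one hx])
    have e2 := hinc q _ (horiz 1 (by simp) q.extend fun x hx => by
      change _ = F (pr 1, pr x)
      rw [hpr1, Path.extend_apply _ hx]
      simp [pr, Set.projIcc_of_mem zero_le_one hx])
    have e3 := hconst x _ (vert 0 (by simp) _ fun t _ => by
      change _ = F (pr t, pr 0)
      rw [hpr0]
      simp)
    have e4 := hconst y _ (vert 1 (by simp) _ fun t _ => by
      change _ = F (pr t, pr 1)
      rw [hpr1]
      simp)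
    rw [e1, e2, e3, e4]
  have htrans : ∀ {x y z : X} (p : Path x y) (q : Path y z),
      inc (p.trans q) = inc p * inc q := by
    intro x y z p q
    have hs := hprim (p.trans q)
    set s := prim (p.trans q) with hsdef
    have hp := hs.comp (j := AffineMap.lineMap (0 : ℝ) (1 / 2)) (h' := p.extend) (L := Set.Icc 0 1)
      (fun x y => by
        rw [dist_lineMap_lineMap]
        have : dist (0 : ℝ) (1 / 2) = 1 / 2 := by norm_num [Real.dist_eq]
        rw [this]
        linarith [dist_nonneg (x := x) (y := y)])
      (convex_Icc _ _)
      (fun x hx => by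
        simp only [AffineMap.lineMap_apply_module, smul_eq_mul]
        constructor <;> linarith [hx.1, hx.2])
      (fun x hx => by
        simp only [AffineMap.lineMap_apply_module, smul_eq_mul]
        rw [Path.extend_trans_of_le_half _ _ (by linarith [hx.2])]
        congr 1
        ring)
    have hq := hs.comp (j := AffineMap.lineMap (1 / 2 : ℝ) 1) (h' := q.extend) (L := Set.Icc 0 1)
      (fun x y => by
        rw [dist_lineMap_lineMap]
        have : dist (1 / 2 : ℝ) 1 = 1 / 2 := by norm_num [Real.dist_eq, abs_of_nonpos]
        rw [this]
        linarith [dist_nonneg (x := x) (y := y)])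
      (convex_Icc _ _)
      (fun x hx => by
        simp only [AffineMap.lineMap_apply_module, smul_eq_mul]
        constructor <;> linarith [hx.1, hx.2])
      (fun x hx => by
        simp only [AffineMap.lineMap_apply_module, smul_eq_mul]
        rw [Path.extend_trans_of_half_le _ _ (by linarith [hx.1])]
        congr 1
        ring)
    rw [hinc p _ hp, hinc q _ hq]
    simp only [Function.comp_apply, AffineMap.lineMap_apply_zero, AffineMap.lineMap_apply_one]
    change (s 0)⁻¹ * s 1 = _
    group
  refine ⟨⟨fun {x y} P => Quotient.lift (fun p => inc p) hhom P, fun {x y z} P Q => ?_⟩, ?_, ?_⟩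
  · induction P, Q using Path.Homotopic.Quotient.ind₂ with
    | mk p q => exact htrans p q
  · intro i x y p hp
    change inc p = _
    rw [hinc p _ (isPrimitive_of_forall_mem hμ p i hp), onSegment_self, inv_one, one_mul]
    refine (μ i).onPath_congr _ _ fun t => ?_
    simp [Path.extend_apply, AffineMap.lineMap_apply_module]
  · intro x y p hp
    change inc p = 1
    rw [hinc p (fun _ => 1) ⟨1, one_pos, fun a _ b _ _ i _ => ?_⟩, inv_one, one_mul]
    rw [onSegment, hp i _ _ _ fun t => ?_, one_mul]
    rw [← Path.extend_range]
    exact ⟨_, rfl⟩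

end Glue

end Holonomy

/-! ### Disjoint branches and free products -/

/-- A family of pairwise disjoint closed subsets `B t` of `X`, attached to the rest of `X` only at
the points `q t`: collapsing the complement of `B t` to `q t` is a continuous map. The branches are
seen from the base point `p` along the paths `stem t`, which meet the branches at most in their
roots. -/
structure BranchFamily (X : Type*) [TopologicalSpace X] (T : Type*) where
  B : T → Set X
  isClosed : ∀ t, IsClosed (B t)
  disjoint : Pairwise fun t u => Disjoint (B t) (B u)
  q : T → X
  collapse : T → C(X, X)
  collapse_of_mem : ∀ t, ∀ x ∈ B t, collapse t x = x
  collapse_of_notMem : ∀ t, ∀ x ∉ B t, collapse t x = q t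
  p : X
  stem : ∀ t, Path p (q t)
  stem_eq_of_mem : ∀ t u x, stem t x ∈ B u → stem t x = q u

namespace BranchFamily

variable {X T : Type*} [TopologicalSpace X] (F : BranchFamily X T)

/-- The element of the fundamental group at the base point given by a loop at the root of a
branch. -/
noncomputable def loopClass {t : T} (l : Path (F.q t) (F.q t)) : FundamentalGroup X F.p :=
  FundamentalGroup.fromPath
    (Path.Homotopic.Quotient.mk (((F.stem t).trans l).trans (F.stem t).symm))

/-- The family indexed by a subset, or a relabelling, of the index type. -/
def reindex {T' : Type*} (e : T' ↪ T) : BranchFamily X T' where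
  B t := F.B (e t)
  isClosed t := F.isClosed (e t)
  disjoint _ _ h := F.disjoint (e.injective.ne h)
  q t := F.q (e t)
  collapse t := F.collapse (e t)
  collapse_of_mem t := F.collapse_of_mem (e t)
  collapse_of_notMem t := F.collapse_of_notMem (e t)
  p := F.p
  stem t := F.stem (e t)
  stem_eq_of_mem t u := F.stem_eq_of_mem (e t) (e u)

variable [PathConnectedSpace X]

/-- Collapsing onto a branch, as a holonomy with values in the free product of the fundamental
groups at the roots. -/
noncomputable def branchHolonomy (t : T) :
    Holonomy X (Monoid.CoprodI fun t => FundamentalGroup X (F.q t)) :=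
  ((Holonomy.tautological (F.q t)).comap (F.collapse t)).postcomp
    (Monoid.CoprodI.of (M := fun t => FundamentalGroup X (F.q t)) (i := t))

theorem branchHolonomy_onPath_of_const {t : T} {x y : X} (γ : Path x y)
    (h : ∀ s, F.collapse t (γ s) = F.q t) : (F.branchHolonomy t).onPath γ = 1 := by
  rw [branchHolonomy, Holonomy.postcomp_onPath, Holonomy.comap_onPath,
    Holonomy.onPath_of_const, map_one]
  intro s
  have h0 := h 0
  rw [γ.source] at h0
  exact (h s).trans h0.symm

theorem branchHolonomy_onPath_of_mem {t : T} (l : Path (F.q t) (F.q t)) (h : ∀ s, l s ∈ F.B t) :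
    (F.branchHolonomy t).onPath l = (Monoid.CoprodI.of
      (M := fun t => FundamentalGroup X (F.q t))
      (FundamentalGroup.fromPath (Path.Homotopic.Quotient.mk l)))⁻¹ := by
  rw [branchHolonomy, Holonomy.postcomp_onPath, Holonomy.comap_onPath, ← map_inv,
    ← Holonomy.tautological_onPath]
  congr 1
  exact Holonomy.onPath_congr _ _ _ fun s => F.collapse_of_mem t _ (h s)

/-- For a finite set of branches, the collapsing holonomies can be glued: `branchHolonomy t` is used
off the other branches. The resulting homomorphism to the free product sends the loops in the
branches to the corresponding elements of the free factors. -/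
theorem exists_hom (S : Finset T) (hS : S.Nonempty) :
    ∃ φ : FundamentalGroup X F.p →* Monoid.CoprodI fun t => FundamentalGroup X (F.q t),
      ∀ t ∈ S, ∀ l : Path (F.q t) (F.q t), (∀ s, l s ∈ F.B t) →
        φ (F.loopClass l) = Monoid.CoprodI.of (M := fun t => FundamentalGroup X (F.q t))
          (FundamentalGroup.fromPath (Path.Homotopic.Quotient.mk l)) := by
  let U : S → Set X := fun i => (⋃ j ∈ {j : S | j ≠ i}, F.B j)ᶜ
  have hmemU : ∀ (i : S) x, x ∈ U i ↔ ∀ j : S, j ≠ i → x ∉ F.B j := fun i x => by simp [U]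
  have hU : ∀ i, IsOpen (U i) := fun i => by
    rw [isOpen_compl_iff]
    exact (Set.toFinite _).isClosed_biUnion fun j _ => F.isClosed j
  have hc : ∀ x, ∃ i, x ∈ U i := by
    intro x
    by_cases h : ∃ i : S, x ∈ F.B i
    · obtain ⟨i, hi⟩ := h
      refine ⟨i, (hmemU i x).2 fun j hj hx => ?_⟩
      exact Set.disjoint_left.1 (F.disjoint fun h => hj (Subtype.ext h)) hx hi
    · push Not at h
      exact ⟨⟨_, hS.choose_spec⟩, (hmemU _ x).2 fun j _ => h j⟩
  have hμ : Holonomy.Compatible (fun i : S => F.branchHolonomy i) U := by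
    intro i j x y γ hi hj
    by_cases hij : i = j
    · rw [hij]
    -- off all branches, both holonomies are trivial
    · rw [F.branchHolonomy_onPath_of_const γ fun s => F.collapse_of_notMem _ _
          ((hmemU j _).1 (hj s) i hij),
        F.branchHolonomy_onPath_of_const γ fun s => F.collapse_of_notMem _ _
          ((hmemU i _).1 (hi s) j (Ne.symm hij))]
  obtain ⟨ν, hν, hν'⟩ := Holonomy.exists_glue hU hc hμ
  refine ⟨ν.toHom F.p, fun t ht l hl => ?_⟩
  have hstem : ν.onPath (F.stem t) = 1 := by
    refine hν' _ _ _ fun u x y γ hγ => F.branchHolonomy_onPath_of_const _ fun s => ?_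
    obtain ⟨s', hs'⟩ := hγ s
    rw [← hs']
    by_cases hs : F.stem t s' ∈ F.B u
    · rw [F.collapse_of_mem _ _ hs, F.stem_eq_of_mem t u s' hs]
    · exact F.collapse_of_notMem _ _ hs
  have hloop : ν.onPath l = (F.branchHolonomy t).onPath l :=
    hν ⟨t, ht⟩ _ _ _ fun s => (hmemU _ _).2 fun j hj hs =>
      Set.disjoint_left.1 (F.disjoint fun h => hj (Subtype.ext h)) hs (hl s)
  rw [loopClass, Holonomy.toHom_mk, Holonomy.onPath_trans, Holonomy.onPath_trans,
    Holonomy.onPath_symm, hstem, hloop, F.branchHolonomy_onPath_of_mem l hl]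
  simp

/-- Essential loops in disjoint branches, multiplied in pairs, generate a free group. -/
theorem lift_loopClass_mul_injective {ι : Type*} (F : BranchFamily X (ι × Bool))
    (l : ∀ t, Path (F.q t) (F.q t)) (hl : ∀ t s, l t s ∈ F.B t)
    (hne : ∀ t, ¬ (l t).Homotopic (Path.refl _)) :
    Function.Injective (FreeGroup.lift fun i : ι =>
      F.loopClass (l (i, false)) * F.loopClass (l (i, true))) := by
  classical
  rw [injective_iff_map_eq_one]
  intro w hw
  by_contra hw1
  let S : Finset (ι × Bool) := (w.toWord.map Prod.fst).toFinset ×ˢ Finset.univ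
  have hS : S.Nonempty := by
    cases h : w.toWord with
    | nil => exact absurd (FreeGroup.toWord_eq_nil_iff.1 h) hw1
    | cons x L => exact ⟨(x.1, true), by simp [S, h]⟩
  obtain ⟨φ, hφ⟩ := F.exists_hom S hS
  refine hw1 ((injective_iff_map_eq_one _).1 (Monoid.CoprodI.injective_lift_of_mul_of
    (P := fun t => FundamentalGroup X (F.q t))
    (fun t => FundamentalGroup.fromPath (Path.Homotopic.Quotient.mk (l t))) fun t ht => ?_) w ?_)
  · exact hne t (Path.Homotopic.Quotient.exact ht)
  · have h := congrArg φ hw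
    rw [map_one, ← MonoidHom.comp_apply, FreeGroup.lift_unique (φ.comp _)
      (f := fun i => φ (F.loopClass (l (i, false)) * F.loopClass (l (i, true)))) (by simp)] at h
    rw [← h]
    refine FreeGroup.lift_apply_eq_of_eqOn w fun x hx => ?_
    have hxS : ∀ b, (x.1, b) ∈ S := fun b => by
      simp only [S, Finset.mem_product, List.mem_toFinset, List.mem_map, Finset.mem_univ, and_true]
      exact ⟨x, hx, rfl⟩
    simp only [map_mul]
    rw [hφ _ (hxS _) _ (hl _), hφ _ (hxS _) _ (hl _)]

/-- A space with uncountably many disjoint branches, each of which carries an essential loop at its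
root, has a large fundamental group. -/
theorem large_fundamentalGroup [Uncountable T] (l : ∀ t, Path (F.q t) (F.q t))
    (hl : ∀ t s, l t s ∈ F.B t) (hne : ∀ t, ¬ (l t).Homotopic (Path.refl _)) (x : X) :
    Uncountable (FundamentalGroup X x) ∧
      HasUncountablyGeneratedFreeSubgroup (FundamentalGroup X x) := by
  obtain ⟨e⟩ : Nonempty (T × Bool ≃ T) := by
    rw [← Cardinal.eq, Cardinal.mk_prod, Cardinal.lift_uzero, Cardinal.mk_bool]
    rw [Cardinal.lift_ofNat, Cardinal.mul_eq_left (Cardinal.aleph0_le_mk T)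
      (Cardinal.ofNat_lt_aleph0.le.trans (Cardinal.aleph0_le_mk T)) two_ne_zero]
  have hinj := (F.reindex e.toEmbedding).lift_loopClass_mul_injective (fun t => l (e t))
    (fun t => hl (e t)) fun t => hne (e t)
  let φ := FundamentalGroup.fundamentalGroupMulEquivOfPathConnected F.p x
  have hinj' := φ.injective.comp hinj
  exact ⟨(hinj'.comp FreeGroup.of_injective).uncountable,
    .of_injective (φ.toMonoidHom.comp (FreeGroup.lift _)) hinj'⟩

end BranchFamily

/-! ### Branches of geodesic spaces -/

/-- `c` restricts to a geodesic from `x` to `y`, parametrized on `[0, 1]` proportionally to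
arc length. -/
structure IsGeodesic {X : Type*} [MetricSpace X] (c : ℝ → X) (x y : X) : Prop where
  zero : c 0 = x
  one : c 1 = y
  dist_eq : ∀ s ∈ Set.Icc (0 : ℝ) 1, ∀ t ∈ Set.Icc (0 : ℝ) 1, dist (c s) (c t) = |s - t| * dist x y

namespace IsGeodesic

variable {X : Type*} [MetricSpace X] {c : ℝ → X} {x y z : X}

theorem continuousOn (hc : IsGeodesic c x y) : ContinuousOn c (Set.Icc 0 1) := by
  refine (LipschitzOnWith.of_dist_le_mul (K := ⟨dist x y, dist_nonneg⟩)
    fun s hs t ht => ?_).continuousOn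
  rw [hc.dist_eq s hs t ht, Real.dist_eq, mul_comm]
  rfl

theorem dist_left (hc : IsGeodesic c x y) {t : ℝ} (ht : t ∈ Set.Icc (0 : ℝ) 1) :
    dist x (c t) = t * dist x y := by
  have := hc.dist_eq 0 (by simp) t ht
  rwa [hc.zero, zero_sub, abs_neg, abs_of_nonneg ht.1] at this

theorem dist_right (hc : IsGeodesic c x y) {t : ℝ} (ht : t ∈ Set.Icc (0 : ℝ) 1) :
    dist (c t) y = (1 - t) * dist x y := by
  have := hc.dist_eq t ht 1 (by simp)
  rwa [hc.one, abs_sub_comm, abs_of_nonneg (by linarith [ht.2])] at this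

theorem injOn (hc : IsGeodesic c x y) (hxy : x ≠ y) : Set.InjOn c (Set.Icc 0 1) := by
  intro s hs t ht h
  have := hc.dist_eq s hs t ht
  rw [h, dist_self, eq_comm, mul_eq_zero, abs_eq_zero, sub_eq_zero] at this
  exact this.resolve_right (dist_ne_zero.2 hxy)

theorem symm (hc : IsGeodesic c x y) : IsGeodesic (fun t => c (1 - t)) y x where
  zero := by simp [hc.one]
  one := by simp [hc.zero]
  dist_eq s hs t ht := by
    rw [hc.dist_eq _ ⟨by linarith [hs.2], by linarith [hs.1]⟩ _
      ⟨by linarith [ht.2], by linarith [ht.1]⟩, dist_comm x y, abs_sub_comm]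
    congr 2
    ring

theorem joinedIn (hc : IsGeodesic c x y) {a b : ℝ} (ha : 0 ≤ a) (hb : b ≤ 1) {F : Set X}
    (h : ∀ t ∈ Set.Icc a b, c t ∈ F) {s t : ℝ} (hs : s ∈ Set.Icc a b) (ht : t ∈ Set.Icc a b) :
    JoinedIn F (c s) (c t) := by
  have h1 : IsPathConnected (c '' Set.Icc a b) :=
    ((convex_Icc a b).isPathConnected ⟨s, hs⟩).image'
      (hc.continuousOn.mono (Set.Icc_subset_Icc ha hb))
  exact (h1.joinedIn _ ⟨s, hs, rfl⟩ _ ⟨t, ht, rfl⟩).mono (Set.image_subset_iff.2 h)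

/-- The part of a geodesic after its starting point avoids that point. -/
theorem joinedIn_compl_left (hc : IsGeodesic c x y) (hxy : x ≠ y) {s t : ℝ}
    (hs : s ∈ Set.Ioc (0 : ℝ) 1) (ht : t ∈ Set.Ioc (0 : ℝ) 1) : JoinedIn {x}ᶜ (c s) (c t) := by
  refine hc.joinedIn (a := min s t) (b := 1) (F := {x}ᶜ) (le_min hs.1.le ht.1.le) le_rfl
    (fun u hu h => ?_) ⟨min_le_left _ _, hs.2⟩ ⟨min_le_right _ _, ht.2⟩
  have hu0 : 0 < u := (lt_min hs.1 ht.1).trans_le hu.1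
  have h' : c u = c 0 := h.trans hc.zero.symm
  exact hu0.ne' (hc.injOn hxy ⟨hu0.le, hu.2⟩ (by simp) h')

theorem exists_eq_of_not_joinedIn (hc : IsGeodesic c x y) (h : ¬ JoinedIn {z}ᶜ x y) :
    ∃ t ∈ Set.Icc (0 : ℝ) 1, c t = z := by
  by_contra! H
  exact h (by simpa [hc.zero, hc.one] using
    hc.joinedIn le_rfl le_rfl (F := {z}ᶜ) H (s := 0) (t := 1) (by simp) (by simp))

end IsGeodesic

/-- Any two points are joined by a geodesic. -/
def IsGeodesicSpace (X : Type*) [MetricSpace X] : Prop :=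
  ∀ x y : X, ∃ c, IsGeodesic c x y

/-- The isometry group acts transitively. -/
def IsIsometricallyHomogeneous (X : Type*) [MetricSpace X] : Prop :=
  ∀ x y : X, ∃ φ : X ≃ᵢ X, φ x = y

section Geodesic

variable {X : Type*} [MetricSpace X]

theorem JoinedIn.map_isometryEquiv {p x y : X} (h : JoinedIn {p}ᶜ x y) (φ : X ≃ᵢ X) :
    JoinedIn {φ p}ᶜ (φ x) (φ y) := by
  refine (h.map φ.continuous).mono ?_
  rintro _ ⟨z, hz, rfl⟩ hz'
  exact hz (φ.injective hz')

namespace IsGeodesicSpace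

theorem pathConnectedSpace [Nonempty X] (geo : IsGeodesicSpace X) : PathConnectedSpace X where
  nonempty := inferInstance
  joined x y := by
    obtain ⟨c, hc⟩ := geo x y
    have := (hc.joinedIn le_rfl le_rfl (F := Set.univ) (fun _ _ => trivial) (s := 0) (t := 1)
      (by simp) (by simp)).joined
    rwa [hc.zero, hc.one] at this

theorem joinedIn_of_dist_lt (geo : IsGeodesicSpace X) {x y z : X} (h : dist x y < dist x z) :
    JoinedIn {z}ᶜ x y := by
  by_contra H
  obtain ⟨c, hc⟩ := geo x y
  obtain ⟨t, ht, rfl⟩ := hc.exists_eq_of_not_joinedIn H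
  rw [hc.dist_left ht] at h
  exact absurd h (not_lt.2 (mul_le_of_le_one_left dist_nonneg ht.2))

theorem dist_add_dist (geo : IsGeodesicSpace X) {x y z : X} (h : ¬ JoinedIn {z}ᶜ x y) :
    dist x z + dist z y = dist x y := by
  obtain ⟨c, hc⟩ := geo x y
  obtain ⟨t, ht, rfl⟩ := hc.exists_eq_of_not_joinedIn h
  rw [hc.dist_left ht, hc.dist_right ht]
  ring

/-- If `z` separates `x` from `y`, the part of a geodesic from `z` to `y` avoids `x`. -/
theorem joinedIn_of_not_joinedIn (geo : IsGeodesicSpace X) {x y z : X} (hz : z ≠ x)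
    (h : ¬ JoinedIn {z}ᶜ x y) : JoinedIn {x}ᶜ z y := by
  obtain ⟨c, hc⟩ := geo x y
  obtain ⟨t, ht, rfl⟩ := hc.exists_eq_of_not_joinedIn h
  have hxy : x ≠ y := by
    rintro rfl
    have := hc.dist_left ht
    rw [dist_self, mul_zero, dist_eq_zero] at this
    exact hz this.symm
  have ht0 : 0 < t := lt_of_le_of_ne ht.1 fun h0 => hz (by rw [← h0, hc.zero])
  simpa [hc.one] using hc.joinedIn_compl_left hxy ⟨ht0, ht.2⟩ (t := 1) (by simp)

theorem isClosed_insert_pathComponentIn_compl (geo : IsGeodesicSpace X) (q b : X) :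
    IsClosed (insert q (pathComponentIn {q}ᶜ b)) := by
  rw [← isOpen_compl_iff, Metric.isOpen_iff]
  intro x hx
  simp only [Set.mem_compl_iff, Set.mem_insert_iff, not_or] at hx
  refine ⟨dist x q, dist_pos.2 hx.1, fun y hy => ?_⟩
  have hxy : JoinedIn {q}ᶜ x y := geo.joinedIn_of_dist_lt (by rwa [dist_comm])
  simp only [Set.mem_compl_iff, Set.mem_insert_iff, not_or]
  exact ⟨hxy.target_mem, fun h => hx.2 (JoinedIn.trans h hxy.symm)⟩

open Classical in
/-- The retraction that is the identity on the component of `b` in the complement of `q` and sends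
everything else to `q`. -/
noncomputable def collapse (geo : IsGeodesicSpace X) (q b : X) : C(X, X) where
  toFun x := if x ∈ pathComponentIn {q}ᶜ b then x else q
  continuous_toFun := by
    have key : ∀ x ∈ pathComponentIn {q}ᶜ b, ∀ y ∉ pathComponentIn {q}ᶜ b,
        dist x q ≤ dist x y := fun x hx y hy => by
      by_contra! h
      exact hy (JoinedIn.trans hx (geo.joinedIn_of_dist_lt h))
    refine (LipschitzWith.of_dist_le_mul (K := 1) fun x y => ?_).continuous
    rw [NNReal.coe_one, one_mul]
    split_ifs with hx hy hy
    · exact le_rfl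
    · exact key x hx y hy
    · rw [dist_comm, dist_comm x]
      exact key y hy x hx
    · simp

theorem collapse_of_mem (geo : IsGeodesicSpace X) {q b x : X}
    (hx : x ∈ insert q (pathComponentIn {q}ᶜ b)) : geo.collapse q b x = x := by
  by_cases h : x ∈ pathComponentIn {q}ᶜ b
  · exact if_pos h
  · exact (if_neg h).trans (hx.resolve_right h).symm

theorem collapse_of_notMem (geo : IsGeodesicSpace X) {q b x : X}
    (hx : x ∉ insert q (pathComponentIn {q}ᶜ b)) : geo.collapse q b x = q :=
  if_neg fun h => hx (Or.inr h)

end IsGeodesicSpace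

/-- In a homogeneous space with a global cut-point, every point separates. -/
theorem HasGlobalCutPoint.exists_not_joinedIn (hom : IsIsometricallyHomogeneous X)
    (hcut : HasGlobalCutPoint X) (p : X) : ∃ x y, x ≠ p ∧ y ≠ p ∧ ¬ JoinedIn {p}ᶜ x y := by
  obtain ⟨p₀, hp₀⟩ := hcut
  obtain ⟨x, y, hx, hy, hxy⟩ : ∃ x y, x ≠ p₀ ∧ y ≠ p₀ ∧ ¬ JoinedIn {p₀}ᶜ x y := by
    by_contra! H
    have hne : Nonempty ({p₀}ᶜ : Set X) := by
      have hp₀' : Nontrivial (ConnectedComponents ({p₀}ᶜ : Set X)) := hp₀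
      obtain ⟨a, -⟩ := hp₀'.exists_pair_ne
      exact (ConnectedComponents.surjective_coe a).nonempty
    have hpc : PathConnectedSpace ({p₀}ᶜ : Set X) :=
      ⟨hne, fun x y => (H x y x.2 y.2).joined_subtype⟩
    have : Subsingleton (ConnectedComponents ({p₀}ᶜ : Set X)) := inferInstance
    exact not_nontrivial _ hp₀
  obtain ⟨φ, hφ⟩ := hom p₀ p
  refine ⟨φ x, φ y, ?_, ?_, fun h => hxy ?_⟩
  · rw [← hφ]; exact φ.injective.ne hx
  · rw [← hφ]; exact φ.injective.ne hy
  · have := h.map_isometryEquiv φ.symm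
    rw [← hφ] at this
    simpa using this

/-- In a homogeneous geodesic space in which all points separate, every component of the complement
of a point is unbounded. Otherwise, looking from a point close to the far end of a bounded
component, all components but one are small; but there is a positive lower bound, the same for all
points by homogeneity, for the size of the second largest component. -/
theorem IsGeodesicSpace.exists_mem_pathComponentIn_dist_gt (geo : IsGeodesicSpace X)
    (hom : IsIsometricallyHomogeneous X) (hcut : HasGlobalCutPoint X) {q b : X} (hb : b ≠ q)
    (R : ℝ) : ∃ x ∈ pathComponentIn {q}ᶜ b, R < dist q x := by
  by_contra! H
  obtain ⟨x, y, hx, hy, hxy⟩ := hcut.exists_not_joinedIn hom q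
  let D : Set ℝ := dist q '' pathComponentIn {q}ᶜ b
  have hD : BddAbove D := ⟨R, by rintro _ ⟨x, hx, rfl⟩; exact H x hx⟩
  have hDne : D.Nonempty := ⟨_, b, mem_pathComponentIn_self hb, rfl⟩
  set δ := min (dist q x) (dist q y)
  have hδ : 0 < δ := lt_min (dist_pos.2 hx.symm) (dist_pos.2 hy.symm)
  obtain ⟨_, ⟨z, hz, rfl⟩, hzD⟩ := exists_lt_of_lt_csSup hDne (sub_lt_self (sSup D) hδ)
  have hzq : z ≠ q := hz.target_mem
  obtain ⟨φ, hφ⟩ := hom q z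
  obtain ⟨u, hu, huz⟩ : ∃ u, δ ≤ dist z u ∧ ¬ JoinedIn {z}ᶜ q u := by
    by_contra! hall
    have h1 := hall (φ x) (by rw [← hφ, φ.dist_eq]; exact min_le_left _ _)
    have h2 := hall (φ y) (by rw [← hφ, φ.dist_eq]; exact min_le_right _ _)
    have := (h1.symm.trans h2).map_isometryEquiv φ.symm
    rw [← hφ] at this
    exact hxy (by simpa using this)
  have h3 : u ∈ pathComponentIn {q}ᶜ b :=
    JoinedIn.trans hz (geo.joinedIn_of_not_joinedIn hzq huz)
  have h4 : dist q u ≤ sSup D := le_csSup hD ⟨u, h3, rfl⟩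
  linarith [geo.dist_add_dist huz]

/-- If the space is not simply connected, then every component of the complement of a point
carries an essential loop at this point: a translate of some essential loop that is far away from
the point, joined to it by a geodesic. -/
theorem IsGeodesicSpace.exists_essential_loop (geo : IsGeodesicSpace X)
    (hom : IsIsometricallyHomogeneous X) (hcut : HasGlobalCutPoint X)
    (hsc : ¬ SimplyConnectedSpace X) {q b : X} (hb : b ≠ q) :
    ∃ l : Path q q, (∀ s, l s ∈ insert q (pathComponentIn {q}ᶜ b)) ∧
      ¬ l.Homotopic (Path.refl q) := by
  have : Nonempty X := ⟨q⟩
  have hpc := geo.pathConnectedSpace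
  rw [simply_connected_iff_loops_nullhomotopic] at hsc
  push Not at hsc
  obtain ⟨o, γ, hγ⟩ := hsc hpc
  obtain ⟨M, hM⟩ := (isCompact_range γ.continuous).isBounded.subset_closedBall o
  obtain ⟨x, hx, hMx⟩ := geo.exists_mem_pathComponentIn_dist_gt hom hcut hb M
  obtain ⟨φ, rfl⟩ := hom o x
  have hloop : ∀ s, φ (γ s) ∈ pathComponentIn {q}ᶜ b := fun s => by
    refine JoinedIn.trans hx (geo.joinedIn_of_dist_lt ?_)
    rw [φ.dist_eq, dist_comm, dist_comm _ q]
    exact lt_of_le_of_lt (hM ⟨s, rfl⟩) hMx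
  obtain ⟨c, hc⟩ := geo q (φ o)
  have hqx : q ≠ φ o := fun h => hx.target_mem h.symm
  let tail : Path q (φ o) :=
    { toFun := fun t => c t
      continuous_toFun := hc.continuousOn.comp_continuous continuous_subtype_val fun t => t.2
      source' := by simpa using hc.zero
      target' := by simpa using hc.one }
  have htail : ∀ t, tail t ∈ insert q (pathComponentIn {q}ᶜ b) := by
    intro t
    rcases t.2.1.eq_or_lt with h | h
    · left
      change c t = q
      rw [← h, hc.zero]
    · right
      refine JoinedIn.trans hx ?_
      have := hc.joinedIn_compl_left hqx (s := 1) (by simp) ⟨h, t.2.2⟩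
      rwa [hc.one] at this
  refine ⟨(tail.trans (γ.map φ.continuous)).trans tail.symm, ?_, fun h => hγ ?_⟩
  · intro s
    have : (tail.trans (γ.map φ.continuous)).trans tail.symm s ∈
        Set.range ((tail.trans (γ.map φ.continuous)).trans tail.symm) := ⟨s, rfl⟩
    rw [Path.trans_range, Path.trans_range, Path.symm_range] at this
    rcases this with (⟨t, ht⟩ | ⟨t, ht⟩) | ⟨t, ht⟩
    · rw [← ht]; exact htail t
    · rw [← ht]; exact Or.inr (hloop t)
    · rw [← ht]; exact htail t
  · have h1 : (γ.map φ.continuous).Homotopic (Path.refl (φ o)) := by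
      rw [← Path.Homotopic.Quotient.eq] at h ⊢
      simp only [Path.Homotopic.Quotient.mk_trans, Path.Homotopic.Quotient.mk_symm,
        Path.Homotopic.Quotient.mk_refl] at h ⊢
      set g := Path.Homotopic.Quotient.mk (γ.map φ.continuous)
      set a := Path.Homotopic.Quotient.mk tail
      calc g = (a.symm.trans ((a.trans g).trans a.symm)).trans a := by
            simp only [Path.Homotopic.Quotient.trans_assoc, Path.Homotopic.Quotient.symm_trans,
              Path.Homotopic.Quotient.trans_refl]
            rw [← Path.Homotopic.Quotient.trans_assoc, Path.Homotopic.Quotient.symm_trans,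
              Path.Homotopic.Quotient.refl_trans]
        _ = _ := by
            rw [h, Path.Homotopic.Quotient.trans_refl, Path.Homotopic.Quotient.symm_trans]
    have h2 := h1.map (⟨φ.symm, φ.symm.continuous⟩ : C(X, X))
    have h3 := h2.pathCast (x₂ := o) (x₃ := o) (by simp) (by simp)
    convert h3 using 1
    · ext t; simp
    · ext t; simp

end Geodesic

/-! ### The dichotomy for homogeneous geodesic spaces with cut-points -/

section Dichotomy

variable {X : Type*} [MetricSpace X]

/-- If every interior point of every geodesic separates its end points, the space is a real tree,
and sliding along geodesics towards a base point contracts it. -/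
theorem IsGeodesicSpace.contractibleSpace [Nonempty X] (geo : IsGeodesicSpace X)
    (sep : ∀ (x y : X) (c : ℝ → X), IsGeodesic c x y → ∀ s ∈ Set.Ioo (0 : ℝ) 1,
      ¬ JoinedIn {c s}ᶜ x y) : ContractibleSpace X := by
  obtain ⟨o⟩ := ‹Nonempty X›
  choose γ hγ using geo o
  -- a point of the geodesic from `o` to `x` lies on the geodesic from `o` to `y` or on one
  -- from `x` to `y`, since together these two make up a path from `o` to `x`
  have tri : ∀ (x y : X) (c : ℝ → X), IsGeodesic c x y → ∀ t ∈ Set.Icc (0 : ℝ) 1,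
      (∃ u ∈ Set.Icc (0 : ℝ) 1, γ y u = γ x t) ∨ ∃ u ∈ Set.Icc (0 : ℝ) 1, c u = γ x t := by
    intro x y c hc t ht
    rcases ht.1.eq_or_lt with rfl | h0
    · exact Or.inl ⟨0, by simp, by rw [(hγ y).zero, (hγ x).zero]⟩
    rcases ht.2.eq_or_lt with rfl | h1
    · exact Or.inr ⟨0, by simp, by rw [hc.zero, (hγ x).one]⟩
    by_contra! H
    refine sep o x (γ x) (hγ x) t ⟨h0, h1⟩ ?_
    have e1 : JoinedIn {γ x t}ᶜ o y := by
      by_contra h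
      obtain ⟨u, hu, hu'⟩ := (hγ y).exists_eq_of_not_joinedIn h
      exact H.1 u hu hu'
    have e2 : JoinedIn {γ x t}ᶜ x y := by
      by_contra h
      obtain ⟨u, hu, hu'⟩ := hc.exists_eq_of_not_joinedIn h
      exact H.2 u hu hu'
    exact e1.trans e2.symm
  have same : ∀ (x y : X), ∀ t ∈ Set.Icc (0 : ℝ) 1, ∀ u ∈ Set.Icc (0 : ℝ) 1, γ y u = γ x t →
      dist (γ x t) (γ y t) ≤ dist x y := by
    intro x y t ht u hu h
    have e1 := (hγ x).dist_left ht
    rw [← h, (hγ y).dist_left hu] at e1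
    rw [← h, (hγ y).dist_eq u hu t ht]
    have e2 : |u - t| * dist o y = |t * (dist o x - dist o y)| := by
      rw [mul_sub, ← e1, ← sub_mul, abs_mul, abs_of_nonneg (dist_nonneg (x := o))]
    rw [e2, abs_mul, abs_of_nonneg ht.1]
    refine (mul_le_of_le_one_left (abs_nonneg _) ht.2).trans ?_
    rw [dist_comm o x, dist_comm o y]
    exact abs_dist_sub_le x y o
  -- sliding along geodesics does not increase distances
  have lip : ∀ (x y : X), ∀ t ∈ Set.Icc (0 : ℝ) 1, dist (γ x t) (γ y t) ≤ dist x y := by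
    intro x y t ht
    obtain ⟨c, hc⟩ := geo x y
    rcases tri x y c hc t ht with ⟨u, hu, h⟩ | ⟨u, hu, h⟩
    · exact same x y t ht u hu h
    rcases tri y x _ hc.symm t ht with ⟨v, hv, h'⟩ | ⟨v, hv, h'⟩
    · rw [dist_comm, dist_comm x]
      exact same y x t ht v hv h'
    · have hv' : 1 - v ∈ Set.Icc (0 : ℝ) 1 := ⟨by linarith [hv.2], by linarith [hv.1]⟩
      rw [← h, ← h', hc.dist_eq u hu _ hv']
      refine mul_le_of_le_one_left dist_nonneg (abs_le.2 ⟨?_, ?_⟩)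
      · linarith [hu.1, hv'.2]
      · linarith [hu.2, hv'.1]
  rw [contractible_iff_id_nullhomotopic]
  refine ⟨o, ⟨ContinuousMap.Homotopy.symm ⟨⟨fun z => γ z.2 z.1, ?_⟩, fun x => ?_, fun x => ?_⟩⟩⟩
  · rw [continuous_iff_continuousAt]
    rintro ⟨t, x⟩
    rw [ContinuousAt, tendsto_iff_dist_tendsto_zero]
    have hlim : Tendsto (fun z : unitInterval × X => dist z.2 x + |(z.1 : ℝ) - t| * dist o x)
        (𝓝 (t, x)) (𝓝 0) := by
      have : Continuous fun z : unitInterval × X => dist z.2 x + |(z.1 : ℝ) - t| * dist o x := by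
        fun_prop
      simpa using this.tendsto (t, x)
    refine squeeze_zero (fun _ => dist_nonneg) (fun z => ?_) hlim
    refine (dist_triangle _ (γ x z.1) _).trans (add_le_add (lip _ _ _ z.1.2) ?_)
    exact ((hγ x).dist_eq _ z.1.2 _ t.2).le
  · simpa using (hγ x).zero
  · simpa using (hγ x).one

/-- The branches along a geodesic. At each of the parameters in `A`, the interior point `c t` does
not separate the end points, so that some component of its complement contains no further point of
the geodesic. -/
theorem IsGeodesicSpace.exists_branchFamily (geo : IsGeodesicSpace X)
    (cut : ∀ p : X, ∃ x y, x ≠ p ∧ y ≠ p ∧ ¬ JoinedIn {p}ᶜ x y) {p r : X} {c : ℝ → X}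
    (hc : IsGeodesic c p r) (hpr : p ≠ r) :
    ∃ F : BranchFamily X {t : ℝ // t ∈ Set.Ioo (0 : ℝ) 1 ∧ JoinedIn {c t}ᶜ p r},
      ∀ t, ∃ b, b ≠ F.q t ∧ F.B t = insert (F.q t) (pathComponentIn {F.q t}ᶜ b) := by
  have hex : ∀ q : X, ∃ b, b ≠ q ∧ ¬ JoinedIn {q}ᶜ b p := by
    intro q
    obtain ⟨x, y, hx, hy, hxy⟩ := cut q
    by_contra! H
    exact hxy ((H x hx).trans (H y hy).symm)
  let T := {t : ℝ // t ∈ Set.Ioo (0 : ℝ) 1 ∧ JoinedIn {c t}ᶜ p r}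
  choose b hb hbp using hex
  have hIcc : ∀ t : T, (t : ℝ) ∈ Set.Icc (0 : ℝ) 1 := fun t => Set.Ioo_subset_Icc_self t.2.1
  let B : T → Set X := fun t => pathComponentIn {c t}ᶜ (b (c t))
  have hjoin : ∀ t : T, ∀ u ∈ Set.Icc (0 : ℝ) 1, u ≠ t → JoinedIn {c t}ᶜ (c u) p := by
    intro t u hu hut
    rcases hut.lt_or_gt with h | h
    · have := hc.joinedIn (F := {c t}ᶜ) le_rfl hu.2 (a := 0) (b := u) (fun v hv hvt => by
        have := hc.injOn hpr ⟨hv.1, hv.2.trans hu.2⟩ (hIcc t) hvt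
        linarith [hv.2]) (s := u) (t := 0) ⟨hu.1, le_rfl⟩ ⟨le_rfl, hu.1⟩
      rwa [hc.zero] at this
    · have := hc.joinedIn (F := {c t}ᶜ) hu.1 le_rfl (a := u) (b := 1) (fun v hv hvt => by
        have := hc.injOn hpr ⟨hu.1.trans hv.1, hv.2⟩ (hIcc t) hvt
        linarith [hv.1]) (s := u) (t := 1) ⟨le_rfl, hu.2⟩ ⟨hu.2, le_rfl⟩
      rw [hc.one] at this
      exact this.trans t.2.2.symm
  have hcB : ∀ t : T, ∀ u ∈ Set.Icc (0 : ℝ) 1, c u ∉ B t := by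
    intro t u hu hmem
    by_cases hut : u = t
    · rw [hut] at hmem
      exact hmem.target_mem rfl
    · exact hbp _ (JoinedIn.trans hmem (hjoin t u hu hut))
  have hinsert : ∀ t : T, ∀ u ∈ Set.Icc (0 : ℝ) 1, c u ∈ insert (c t) (B t) → c u = c t :=
    fun t u hu h => h.resolve_right (hcB t u hu)
  have hxp : ∀ t : T, ∀ x ∈ B t, ¬ JoinedIn {c t}ᶜ x p := fun t x hx h =>
    hbp _ (JoinedIn.trans hx h)
  have hdisj : ∀ t u : T, t ≠ u → Disjoint (insert (c t) (B t)) (insert (c u) (B u)) := by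
    intro t u htu
    have hcc : c t ≠ c u := fun h => htu (Subtype.ext (hc.injOn hpr (hIcc t) (hIcc u) h))
    rw [Set.disjoint_left]
    rintro x (rfl | hx) (hx' | hx')
    · exact hcc hx'
    · exact hcB u t (hIcc t) hx'
    · rw [hx'] at hx
      exact hcB t u (hIcc u) hx
    -- a geodesic from `x` to `p` passes through both `c t` and `c u`
    · obtain ⟨g, hg⟩ := geo x p
      have main : ∀ t u : T, x ∈ B t → x ∈ B u → ∀ v ∈ Set.Icc (0 : ℝ) 1,
          ∀ w ∈ Set.Icc (0 : ℝ) 1, g v = c t → g w = c u → v < w → False := by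
        intro t u hx hx' v hv w hw hvt hwu hvw
        have hxp' : x ≠ p := fun h => hcB t 0 (by simp) (by rwa [hc.zero, ← h])
        have := hg.joinedIn (F := {c u}ᶜ) le_rfl hv.2 (a := 0) (b := v) (fun z hz hzu => by
          have := hg.injOn hxp' ⟨hz.1, hz.2.trans hv.2⟩ hw (Eq.trans hzu hwu.symm)
          linarith [hz.2]) (s := 0) (t := v) ⟨le_rfl, hv.1⟩ ⟨hv.1, le_rfl⟩
        rw [hg.zero, hvt] at this
        exact hcB u t (hIcc t) (JoinedIn.trans hx' this)
      obtain ⟨v, hv, hvt⟩ := hg.exists_eq_of_not_joinedIn (hxp t x hx)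
      obtain ⟨w, hw, hwu⟩ := hg.exists_eq_of_not_joinedIn (hxp u x hx')
      rcases lt_trichotomy v w with h | h | h
      · exact main t u hx hx' v hv w hw hvt hwu h
      · exact hcc (by rw [← hvt, ← hwu, h])
      · exact main u t hx' hx w hw v hv hwu hvt h
  have hmul : ∀ (t : T) (s : unitInterval), (s : ℝ) * t ∈ Set.Icc (0 : ℝ) 1 := fun t s =>
    ⟨mul_nonneg s.2.1 (hIcc t).1, mul_le_one₀ s.2.2 (hIcc t).1 (hIcc t).2⟩
  exact ⟨{
    B := fun t => insert (c t) (B t)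
    isClosed := fun t => geo.isClosed_insert_pathComponentIn_compl _ _
    disjoint := fun t u h => hdisj t u h
    q := fun t => c t
    collapse := fun t => geo.collapse (c t) (b (c t))
    collapse_of_mem := fun t x hx => geo.collapse_of_mem hx
    collapse_of_notMem := fun t x hx => geo.collapse_of_notMem hx
    p := p
    stem := fun t =>
      { toFun := fun s => c (s * t)
        continuous_toFun := hc.continuousOn.comp_continuous (by fun_prop) (hmul t)
        source' := by simp [hc.zero]
        target' := by simp }
    stem_eq_of_mem := fun t u s hs => hinsert u _ (hmul t s) hs },
    fun t => ⟨b (c t), hb _, rfl⟩⟩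

/-- A homogeneous geodesic space with a global cut-point is simply connected or has a large
fundamental group. -/
theorem IsGeodesicSpace.simplyConnected_or_large (geo : IsGeodesicSpace X)
    (hom : IsIsometricallyHomogeneous X) (hcut : HasGlobalCutPoint X) :
    SimplyConnectedOrLargeFundamentalGroup X := by
  have : Nonempty X := ⟨hcut.choose⟩
  by_cases sep : ∀ (x y : X) (c : ℝ → X), IsGeodesic c x y → ∀ s ∈ Set.Ioo (0 : ℝ) 1,
      ¬ JoinedIn {c s}ᶜ x y
  · have := geo.contractibleSpace sep
    exact Or.inl inferInstance
  by_cases hsc : SimplyConnectedSpace X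
  · exact Or.inl hsc
  refine Or.inr fun x => ?_
  have := geo.pathConnectedSpace
  push Not at sep
  obtain ⟨p, r, c, hc, s, hs, hj⟩ := sep
  have hpr : p ≠ r := by
    rintro rfl
    have := hc.dist_left (Set.Ioo_subset_Icc_self hs)
    rw [dist_self, mul_zero, dist_eq_zero] at this
    exact hj.source_mem this
  obtain ⟨F, hF⟩ := geo.exists_branchFamily (hcut.exists_not_joinedIn hom) hc hpr
  -- a path that avoids `c s` also avoids the nearby points of the geodesic
  have hunc : Uncountable {t : ℝ // t ∈ Set.Ioo (0 : ℝ) 1 ∧ JoinedIn {c t}ᶜ p r} := by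
    have hnhds : {t : ℝ | t ∈ Set.Ioo (0 : ℝ) 1 ∧ JoinedIn {c t}ᶜ p r} ∈ 𝓝 s := by
      obtain ⟨σ, hσ⟩ := hj
      have hIoo : Set.Ioo (0 : ℝ) 1 ∈ 𝓝 s := Ioo_mem_nhds hs.1 hs.2
      have hcs : ContinuousAt c s :=
        hc.continuousOn.continuousAt (mem_of_superset hIoo Set.Ioo_subset_Icc_self)
      have hop : (Set.range σ)ᶜ ∈ 𝓝 (c s) :=
        (isCompact_range σ.continuous).isClosed.isOpen_compl.mem_nhds (by
          rintro ⟨t, ht⟩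
          exact hσ t ht)
      filter_upwards [hIoo, hcs hop] with t ht ht'
      exact ⟨ht, σ, fun v hv => ht' ⟨v, hv⟩⟩
    rw [← not_countable_iff]
    intro hcount
    have := cardinal_eq_of_mem_nhds ℝ hnhds
    have h2 : (Set.Countable {t : ℝ | t ∈ Set.Ioo (0 : ℝ) 1 ∧ JoinedIn {c t}ᶜ p r}) := hcount
    rw [Cardinal.mk_real] at this
    exact absurd h2.le_aleph0 (not_le.2 (this ▸ Cardinal.aleph0_lt_continuum))
  have hloops : ∀ t, ∃ l : Path (F.q t) (F.q t), (∀ s, l s ∈ F.B t) ∧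
      ¬ l.Homotopic (Path.refl _) := by
    intro t
    obtain ⟨b, hb, hB⟩ := hF t
    obtain ⟨l, hl, hne⟩ := geo.exists_essential_loop hom hcut hsc hb
    exact ⟨l, fun s => hB ▸ hl s, hne⟩
  choose l hl hne using hloops
  exact F.large_fundamentalGroup l hl hne x

end Dichotomy

/-! ### Asymptotic cones of groups -/

section ConeMetric

variable {ω : Ultrafilter ℕ} {X : Type*} [MetricSpace X] {e : ℕ → X} {d : ScalingSequence ω}

/-- The point of the cone represented by a sequence. -/
noncomputable def AsymptoticCone.mk (x : ConeSequence ω X e d) : AsymptoticCone ω X e d :=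
  SeparationQuotient.mk x

theorem AsymptoticCone.mk_surjective :
    Function.Surjective (AsymptoticCone.mk : ConeSequence ω X e d → AsymptoticCone ω X e d) :=
  SeparationQuotient.surjective_mk

theorem AsymptoticCone.tendsto_dist (x y : ConeSequence ω X e d) :
    Tendsto (fun n => dist (x.1 n) (y.1 n) / d.val n) (ω : Filter ℕ)
      (𝓝 (dist (AsymptoticCone.mk x) (AsymptoticCone.mk y))) :=
  x.tendsto y

theorem AsymptoticCone.dist_mk_eq {x y : ConeSequence ω X e d} {a : ℝ}
    (h : Tendsto (fun n => dist (x.1 n) (y.1 n) / d.val n) (ω : Filter ℕ) (𝓝 a)) :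
    dist (AsymptoticCone.mk x) (AsymptoticCone.mk y) = a :=
  tendsto_nhds_unique (AsymptoticCone.tendsto_dist x y) h

theorem ScalingSequence.tendsto_const_div (d : ScalingSequence ω) (a : ℝ) :
    Tendsto (fun n => a / d.val n) (ω : Filter ℕ) (𝓝 0) :=
  tendsto_const_nhds.div_atTop
    (tendsto_atTop.2 fun M => (d.diverges M).mono fun _ h => h.le)

/-- A sequence that lies at bounded scaled distance from a sequence representing a point of the
cone represents a point of the cone as well. -/
def ConeSequence.ofDistLe (x : ConeSequence ω X e d) (z : ℕ → X) (M : ℝ)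
    (h : ∀ᶠ n in (ω : Filter ℕ), dist (z n) (x.1 n) / d.val n ≤ M) : ConeSequence ω X e d :=
  ⟨z, by
    obtain ⟨N, hN⟩ := x.2
    refine ⟨M + N, ?_⟩
    filter_upwards [h, hN] with n h1 h2
    calc dist (z n) (e n) / d.val n
        ≤ (dist (z n) (x.1 n) + dist (x.1 n) (e n)) / d.val n :=
          div_le_div_of_nonneg_right (dist_triangle _ _ _) (d.pos n).le
      _ = dist (z n) (x.1 n) / d.val n + dist (x.1 n) (e n) / d.val n := add_div _ _ _
      _ < M + N := add_lt_add_of_le_of_lt h1 h2⟩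

/-- Cones of spaces with discrete geodesics are geodesic. -/
theorem AsymptoticCone.isGeodesicSpace
    (hX : ∀ x y : X, ∃ (l : ℕ) (γ : ℕ → X), (l : ℝ) = dist x y ∧ γ 0 = x ∧ γ l = y ∧
      ∀ i ≤ l, ∀ j ≤ l, dist (γ i) (γ j) = |(i : ℝ) - j|) :
    IsGeodesicSpace (AsymptoticCone ω X e d) := by
  intro a b
  obtain ⟨x, rfl⟩ := AsymptoticCone.mk_surjective a
  obtain ⟨y, rfl⟩ := AsymptoticCone.mk_surjective b
  choose l γ hl h0 h1 hγ using fun n => hX (x.1 n) (y.1 n)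
  let pr : ℝ → ℝ := fun t => (Set.projIcc (0 : ℝ) 1 zero_le_one t : ℝ)
  have hpr : ∀ t, pr t ∈ Set.Icc (0 : ℝ) 1 := fun t => Subtype.mem _
  have hpr' : ∀ t ∈ Set.Icc (0 : ℝ) 1, pr t = t := fun t ht => by
    simp [pr, Set.projIcc_of_mem zero_le_one ht]
  have hfloor : ∀ t n, ⌊pr t * l n⌋₊ ≤ l n := fun t n => by
    refine Nat.floor_le_of_le (mul_le_of_le_one_left (Nat.cast_nonneg _) (hpr t).2)
  obtain ⟨M, hM⟩ := x.bounded y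
  let z : ℝ → ConeSequence ω X e d := fun t => x.ofDistLe (fun n => γ n ⌊pr t * l n⌋₊) M (by
    filter_upwards [hM] with n hn
    refine le_trans (div_le_div_of_nonneg_right ?_ (d.pos n).le) hn.2
    rw [← hl, ← h0, hγ n _ (hfloor t n) 0 (Nat.zero_le _), Nat.cast_zero, sub_zero,
      abs_of_nonneg (Nat.cast_nonneg _)]
    exact_mod_cast hfloor t n)
  have hz : ∀ t n, (z t).1 n = γ n ⌊pr t * l n⌋₊ := fun t n => rfl
  refine ⟨fun t => AsymptoticCone.mk (z t), ?_, ?_, fun s hs t ht => ?_⟩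
  · congr 1
    refine Subtype.ext (funext fun n => ?_)
    rw [hz, hpr' 0 (by simp), zero_mul, Nat.floor_zero, h0]
  · congr 1
    refine Subtype.ext (funext fun n => ?_)
    rw [hz, hpr' 1 (by simp), one_mul, Nat.floor_natCast, h1]
  · refine AsymptoticCone.dist_mk_eq ?_
    have hlim := (AsymptoticCone.tendsto_dist x y).const_mul |s - t|
    -- rounding changes distances by at most one, which vanishes in the limit
    refine tendsto_of_tendsto_of_dist hlim
      (squeeze_zero (fun _ => dist_nonneg) (fun n => ?_) (d.tendsto_const_div 1))
    rw [hz, hz, hγ n _ (hfloor s n) _ (hfloor t n), hpr' s hs, hpr' t ht, ← hl, Real.dist_eq,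
      mul_div_assoc', ← sub_div, abs_div, abs_of_pos (d.pos n)]
    refine div_le_div_of_nonneg_right ?_ (d.pos n).le
    have e1 : |s - t| * (l n : ℝ) = |s * l n - t * l n| := by
      rw [← sub_mul, abs_mul, abs_of_nonneg (Nat.cast_nonneg (α := ℝ) (l n))]
    rw [e1]
    refine (abs_abs_sub_abs_le _ _).trans ?_
    have a1 := Nat.floor_le (mul_nonneg hs.1 (Nat.cast_nonneg (α := ℝ) (l n)))
    have a2 := Nat.lt_floor_add_one (s * (l n : ℝ))
    have b1 := Nat.floor_le (mul_nonneg ht.1 (Nat.cast_nonneg (α := ℝ) (l n)))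
    have b2 := Nat.lt_floor_add_one (t * (l n : ℝ))
    rw [abs_le]
    constructor <;> linarith

/-- Cones of homogeneous spaces are homogeneous: a sequence of isometries of `X` acts on the
cone if it moves some point of the cone to a point of the cone. -/
theorem AsymptoticCone.isIsometricallyHomogeneous (hX : IsIsometricallyHomogeneous X) :
    IsIsometricallyHomogeneous (AsymptoticCone ω X e d) := by
  have key : ∀ (x y : ConeSequence ω X e d) (φ : ℕ → X ≃ᵢ X), (∀ n, φ n (x.1 n) = y.1 n) →
      ∃ f : AsymptoticCone ω X e d → AsymptoticCone ω X e d, Isometry f ∧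
        ∀ z w : ConeSequence ω X e d, (∀ n, w.1 n = φ n (z.1 n)) →
          f (AsymptoticCone.mk z) = AsymptoticCone.mk w := by
    intro x y φ hφ
    have hT : ∀ z : ConeSequence ω X e d, ∃ w : ConeSequence ω X e d,
        ∀ n, w.1 n = φ n (z.1 n) := fun z => by
      obtain ⟨M, hM⟩ := z.bounded x
      refine ⟨y.ofDistLe (fun n => φ n (z.1 n)) M (hM.mono fun n hn => ?_), fun n => rfl⟩
      rw [← hφ, (φ n).dist_eq]
      exact hn.2
    have hdist : ∀ z w z' w' : ConeSequence ω X e d, (∀ n, w.1 n = φ n (z.1 n)) →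
        (∀ n, w'.1 n = φ n (z'.1 n)) → dist (AsymptoticCone.mk w) (AsymptoticCone.mk w') =
          dist (AsymptoticCone.mk z) (AsymptoticCone.mk z') := fun z w z' w' h h' => by
      refine AsymptoticCone.dist_mk_eq ((AsymptoticCone.tendsto_dist z z').congr fun n => ?_)
      rw [h, h', (φ n).dist_eq]
    choose T hT using hT
    choose rep hrep using AsymptoticCone.mk_surjective (ω := ω) (X := X) (e := e) (d := d)
    refine ⟨fun a => AsymptoticCone.mk (T (rep a)), Isometry.of_dist_eq fun a b => ?_,
      fun z w h => ?_⟩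
    · rw [hdist _ _ _ _ (hT (rep a)) (hT (rep b)), hrep, hrep]
    · refine eq_of_dist_eq_zero ?_
      rw [hdist _ _ _ _ (hT _) h, hrep, dist_self]
  intro a b
  obtain ⟨x, rfl⟩ := AsymptoticCone.mk_surjective a
  obtain ⟨y, rfl⟩ := AsymptoticCone.mk_surjective b
  choose φ hφ using fun n => hX (x.1 n) (y.1 n)
  obtain ⟨f, hf, hf'⟩ := key x y φ hφ
  obtain ⟨g, -, hg'⟩ := key y x (fun n => (φ n).symm) fun n => by rw [← hφ]; simp
  refine ⟨IsometryEquiv.mk' f g (fun a => ?_) hf, hf' x y fun n => (hφ n).symm⟩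
  obtain ⟨z, rfl⟩ := AsymptoticCone.mk_surjective a
  obtain ⟨M, hM⟩ := z.bounded y
  have hw' : ∃ w : ConeSequence ω X e d, ∀ n, w.1 n = (φ n).symm (z.1 n) := by
    refine ⟨x.ofDistLe (fun n => (φ n).symm (z.1 n)) M (hM.mono fun n hn => ?_), fun n => rfl⟩
    have : x.1 n = (φ n).symm (y.1 n) := by rw [← hφ]; simp
    rw [this, (φ n).symm.dist_eq]
    exact hn.2
  obtain ⟨w, hw⟩ := hw'
  rw [hg' z w hw, hf' w z fun n => by rw [hw]; simp]

end ConeMetric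

section WordMetric

variable {G : Type*} [Group G] (S : Finset G) (hS : Subgroup.closure (S : Set G) = ⊤)

theorem WordMetricSpace.isIsometricallyHomogeneous :
    IsIsometricallyHomogeneous (WordMetricSpace S hS) := by
  intro x y
  let u : G := x
  let v : G := y
  let L : G → WordMetricSpace S hS → WordMetricSpace S hS := fun g (z : G) => (g * z : G)
  have hL : ∀ g, Isometry (L g) := fun g =>
    Isometry.of_dist_eq fun (z w : G) => by
      change (wordLength S ((g * z)⁻¹ * (g * w)) : ℝ) = wordLength S (z⁻¹ * w)
      congr 2
      group
  refine ⟨IsometryEquiv.mk' (L (v * u⁻¹)) (L (u * v⁻¹)) (fun (z : G) => ?_) (hL _), ?_⟩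
  · change v * u⁻¹ * (u * v⁻¹ * z) = z
    group
  · change v * u⁻¹ * u = v
    group

/-- The prefixes of a shortest word form a discrete geodesic. -/
theorem WordMetricSpace.exists_discrete_geodesic (x y : WordMetricSpace S hS) :
    ∃ (l : ℕ) (γ : ℕ → WordMetricSpace S hS), (l : ℝ) = dist x y ∧ γ 0 = x ∧ γ l = y ∧
      ∀ i ≤ l, ∀ j ≤ l, dist (γ i) (γ j) = |(i : ℝ) - j| := by
  let u : G := x
  let v : G := y
  obtain ⟨w, hw, hwS, hwp⟩ := exists_word hS (u⁻¹ * v)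
  let γ : ℕ → WordMetricSpace S hS := fun i => (u * (w.take i).prod : G)
  have h0 : γ 0 = x := by
    change u * (w.take 0).prod = u
    simp
  have h1 : γ w.length = y := by
    change u * (w.take w.length).prod = v
    rw [List.take_length, hwp]
    group
  have hl : (w.length : ℝ) = dist x y := by rw [hw]; rfl
  have hle : ∀ i j, i ≤ j → j ≤ w.length → dist (γ i) (γ j) ≤ (j : ℝ) - i := by
    intro i j hij hj
    have hsub : (u * (w.take i).prod)⁻¹ * (u * (w.take j).prod) = ((w.take j).drop i).prod := by
      have := List.prod_take_mul_prod_drop (w.take j) i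
      rw [List.take_take, min_eq_left hij] at this
      rw [← this]
      group
    have h2 := wordLength_le (S := S) ((w.take j).drop i) fun a ha =>
      hwS a (List.mem_of_mem_take (List.mem_of_mem_drop ha))
    rw [← hsub, List.length_drop, List.length_take, min_eq_left hj] at h2
    change (wordLength S ((u * (w.take i).prod)⁻¹ * (u * (w.take j).prod)) : ℝ) ≤ _
    rw [← Nat.cast_sub hij]
    exact_mod_cast h2
  have heq : ∀ i j, i ≤ j → j ≤ w.length → dist (γ i) (γ j) = (j : ℝ) - i := by
    intro i j hij hj
    refine le_antisymm (hle i j hij hj) ?_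
    have t1 := dist_triangle4 x (γ i) (γ j) y
    have t2 := hle 0 i (Nat.zero_le _) (hij.trans hj)
    have t3 := hle j w.length hj le_rfl
    rw [h0] at t2
    rw [h1] at t3
    push_cast at t2
    linarith
  refine ⟨w.length, γ, hl, h0, h1, fun i hi j hj => ?_⟩
  rcases le_total i j with h | h
  · rw [heq i j h hj, abs_sub_comm, abs_of_nonneg (by simpa using h)]
  · rw [dist_comm, heq j i h hi, abs_of_nonneg (by simpa using h)]

end WordMetric

theorem mainTheorem1 {G : Type*} [Group G] (S : Finset G)
    (hS : Subgroup.closure (S : Set G) = ⊤) :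
    (∀ (ω : Ultrafilter ℕ) (e : ℕ → WordMetricSpace S hS) (d : ScalingSequence ω),
      HasGlobalCutPoint (AsymptoticCone ω (WordMetricSpace S hS) e d) →
        SimplyConnectedOrLargeFundamentalGroup
          (AsymptoticCone ω (WordMetricSpace S hS) e d)) ∧
    (IsConstricted (WordMetricSpace S hS) →
      ∀ (ω : Ultrafilter ℕ) (e : ℕ → WordMetricSpace S hS) (d : ScalingSequence ω),
        SimplyConnectedOrLargeFundamentalGroup
          (AsymptoticCone ω (WordMetricSpace S hS) e d)) ∧
    (¬ IsWide (WordMetricSpace S hS) →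
      ∃ (ω : Ultrafilter ℕ) (e : ℕ → WordMetricSpace S hS) (d : ScalingSequence ω),
        SimplyConnectedOrLargeFundamentalGroup
          (AsymptoticCone ω (WordMetricSpace S hS) e d)) := by
  have main : ∀ (ω : Ultrafilter ℕ) (e : ℕ → WordMetricSpace S hS) (d : ScalingSequence ω),
      HasGlobalCutPoint (AsymptoticCone ω (WordMetricSpace S hS) e d) →
        SimplyConnectedOrLargeFundamentalGroup
          (AsymptoticCone ω (WordMetricSpace S hS) e d) := fun ω e d hcut =>
    (AsymptoticCone.isGeodesicSpace
      (WordMetricSpace.exists_discrete_geodesic S hS)).simplyConnected_or_large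
      (AsymptoticCone.isIsometricallyHomogeneous
        (WordMetricSpace.isIsometricallyHomogeneous S hS)) hcut
  refine ⟨main, fun hG ω e d => main ω e d (hG ω e d), fun hG => ?_⟩
  simp only [IsWide, not_forall, not_not] at hG
  obtain ⟨ω, e, d, hcut⟩ := hG
  exact ⟨ω, e, d, main ω e d hcut⟩
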